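/- For nonzero integers $m,n$ let $BS(m,n)=\langle a,t\mid ta^mt^{-1}=a^n\rangle$ be the Baumslag--Solitar group, and let $\overline{BS}(m,n)=BS(m,n)/\langle\langle a\rangle\rangle'$ be its metabelian quotient, where $\langle\langle a\rangle\rangle'$ is the commutator subgroup of the normal closure of $a$. For an elementary amenable group $G$ let $h(G)\in\{0,1,2,\dots,\infty\}$ be its Hirsch length (which is $0$ for finite groups, $1$ for $\mathbb{Z}$, additive in extensions, and the least upper bound of the Hirsch lengths of the members for directed unions), and let $\sqrt{G}$ be the Hirsch--Plotkin radical of $G$, i.e. its unique maximal locally nilpotent normal subgroup. **Lemma.** Let $G$ be a finitely generated, torsion-free elementary amenable group with $h(G)=3$ and $h(\sqrt{G})=1$. Then there are coprime integers $m,n$ with $0<m\leq|n|$ such that $mn$ has at least two distinct prime factors, and an automorphism $\theta$ of $\overline{BS}(m,n)$, such that $G\cong\overline{BS}(m,n)\rtimes_\theta\mathbb{Z}$. -/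

import Mathlib

universe u

/-- The class of elementary amenable groups: the smallest class of groups which contains all
finite groups and all abelian groups and is closed under passing to (groups isomorphic to)
subgroups and quotients, under extensions, and under directed unions. -/
inductive IsElementaryAmenable : (G : Type u) → [Group G] → Prop
  | of_finite (G : Type u) [Group G] [Finite G] : IsElementaryAmenable G
  | of_comm (G : Type u) [Group G] (h : ∀ a b : G, a * b = b * a) : IsElementaryAmenable G
  | of_injective {G H : Type u} [Group G] [Group H] (f : H →* G) (hf : Function.Injective f)
      (hG : IsElementaryAmenable G) : IsElementaryAmenable H
  | of_surjective {G H : Type u} [Group G] [Group H] (f : G →* H) (hf : Function.Surjective f)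
      (hG : IsElementaryAmenable G) : IsElementaryAmenable H
  | of_extension {G : Type u} [Group G] (N : Subgroup G) [N.Normal]
      (hN : IsElementaryAmenable N) (hQ : IsElementaryAmenable (G ⧸ N)) : IsElementaryAmenable G
  | of_directed {G : Type u} [Group G] {ι : Type u} [Nonempty ι] (F : ι → Subgroup G)
      (hdir : Directed (· ≤ ·) F) (hsup : ⨆ i, F i = ⊤)
      (hF : ∀ i, IsElementaryAmenable (F i)) : IsElementaryAmenable G

/-- `HasHirschLength G n` says that the Hirsch length of the elementary amenable group `G` can be
computed to be `n` by the defining rules: finite groups have Hirsch length `0`, the infinite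
cyclic group has Hirsch length `1`, Hirsch length is an isomorphism invariant, it is additive in
extensions, and the Hirsch length of a directed union is the least upper bound of the Hirsch
lengths of its members. Every elementary amenable group is obtained from finite groups and `ℤ` by
extensions and directed unions, and the value computed is independent of how this is done. -/
inductive HasHirschLength : (G : Type u) → [Group G] → ℕ∞ → Prop
  | of_finite (G : Type u) [Group G] [Finite G] : HasHirschLength G 0
  | of_int {G : Type u} [Group G] (e : Multiplicative ℤ ≃* G) : HasHirschLength G 1
  | of_mulEquiv {G H : Type u} [Group G] [Group H] {n : ℕ∞} (e : G ≃* H)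
      (hG : HasHirschLength G n) : HasHirschLength H n
  | of_extension {G : Type u} [Group G] (N : Subgroup G) [N.Normal] {a b : ℕ∞}
      (hN : HasHirschLength N a) (hQ : HasHirschLength (G ⧸ N) b) : HasHirschLength G (a + b)
  | of_directed {G : Type u} [Group G] {ι : Type u} [Nonempty ι] (F : ι → Subgroup G)
      (hdir : Directed (· ≤ ·) F) (hsup : ⨆ i, F i = ⊤) (n : ι → ℕ∞)
      (hF : ∀ i, HasHirschLength (F i) (n i)) : HasHirschLength G (⨆ i, n i)

/-- The Hirsch length `h(G)` of an elementary amenable group `G`: the (unique) value `n` with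
`HasHirschLength G n`. The infimum is only a device for extracting this value. -/
noncomputable def hirschLength (G : Type u) [Group G] : ℕ∞ :=
  sInf {n : ℕ∞ | HasHirschLength G n}

/-- A group is locally nilpotent if all its finitely generated subgroups are nilpotent. -/
def IsLocallyNilpotent (G : Type u) [Group G] : Prop :=
  ∀ H : Subgroup G, H.FG → Group.IsNilpotent H

/-- The Hirsch–Plotkin radical `√G`: the join of all locally nilpotent normal subgroups of `G`,
which is the largest locally nilpotent normal subgroup. -/
def hirschPlotkinRadical (G : Type u) [Group G] : Subgroup G :=
  sSup {N : Subgroup G | N.Normal ∧ IsLocallyNilpotent N}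

/-- The Baumslag–Solitar group `BS(m, n) = ⟨a, t ∣ t a ^ m t⁻¹ = a ^ n⟩`; the generator of the
free group indexed by `0` is `a`, the one indexed by `1` is `t`. -/
abbrev BaumslagSolitar (m n : ℤ) : Type :=
  PresentedGroup ({FreeGroup.of 1 * FreeGroup.of 0 ^ m * (FreeGroup.of 1)⁻¹ *
    (FreeGroup.of 0 ^ n)⁻¹} : Set (FreeGroup (Fin 2)))

/-- The normal closure `⟨⟨a⟩⟩` of `a` in `BS(m, n)`. -/
abbrev BaumslagSolitar.base (m n : ℤ) : Subgroup (BaumslagSolitar m n) :=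
  Subgroup.normalClosure {PresentedGroup.of 0}

/-- The metabelian quotient `BS(m, n) / ⟨⟨a⟩⟩'` of the Baumslag–Solitar group, where `⟨⟨a⟩⟩'` is
the commutator subgroup of the normal closure of `a`. -/
abbrev MetabelianBaumslagSolitar (m n : ℤ) : Type :=
  BaumslagSolitar m n ⧸ ⁅BaumslagSolitar.base m n, BaumslagSolitar.base m n⁆

-- Write A for √G. A torsion-free locally nilpotent group of rank one is abelian, and the locally
-- nilpotent normal subgroups of G, all of rank at most one, centralize each other. So A is
-- torsion-free abelian of rank one, that is, a subgroup of ℚ, and G acts on it by conjugation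
-- through a character χ with nonzero rational values.
--
-- The decisive step is that A is its own centralizer C (`centralizer_hirschPlotkinRadical_le`).
-- Since G/A has Hirsch length at most two, its third derived subgroup is locally finite
-- (`HasHirschLength.isLocallyFinite_derivedSeries_three`). By Schur's theorem the commutator
-- subgroup of C ∩ G⁽³⁾ is locally finite, hence trivial, so C ∩ G⁽³⁾ is abelian and lies in A. If C
-- ∩ G⁽ᵏ⁺¹⁾ lies in A, then C ∩ G⁽ᵏ⁾ is nilpotent of class at most two and lies in A as well; at k =
-- 0 this says C ≤ A.
--
-- Hence χ embeds G/A in the multiplicative group of ℚ. The quotient is torsion-free: an element g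
-- acting as -1 with g² in A would both fix and invert g². So G/A is free abelian of rank two with a
-- basis given by some x and y, and χ(x), χ(y) are multiplicatively independent. Take g = x^i y^(±1)
-- with i such that no prime of χ(x) or χ(y) cancels in χ(g) = n/m
-- (`exists_coprime_of_independent`); at least two primes occur because powers of one prime, up to
-- sign, are dependent. Finite generation of G makes A a copy of ℤ[1/mn] generated by some a
-- (`RationalCoordinates.exists_generator`). Then a and g generate a copy of the metabelian
-- Baumslag–Solitar group which contains A, so it is normal, and ⟨x⟩ is a complement.
--
-- The Hirsch length enters only through chains of subgroups: if the rules yield the value n, there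
-- is a chain of length r exactly when r ≤ n (`HasHirschLength.le_of_chain`,
-- `HasHirschLength.chain_of_le`).

universe v w

/-! ### Chains of subgroups as a measure of Hirsch length -/

/-- `NontorsionChain K r` says that some ascending chain of subgroups ending in `K` contains `r`
inclusions which are normal and have a quotient with an element of infinite order. The supremum of
the lengths of such chains is an intrinsic description of the Hirsch length. -/
inductive NontorsionChain {G : Type v} [Group G] : Subgroup G → ℕ → Prop
  | base (K : Subgroup G) : NontorsionChain K 0
  | weaken {K L : Subgroup G} {r : ℕ} (h : NontorsionChain K r) (hKL : K ≤ L) :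
      NontorsionChain L r
  | step {K L : Subgroup G} {r : ℕ} (h : NontorsionChain K r) (hKL : K ≤ L)
      (hn : ∀ g ∈ L, ∀ k ∈ K, g * k * g⁻¹ ∈ K) (x : G) (hx : x ∈ L)
      (hxK : ∀ j : ℕ, 0 < j → x ^ j ∉ K) : NontorsionChain L (r + 1)

namespace NontorsionChain

variable {G : Type v} [Group G] {H : Type w} [Group H]

theorem mono {K : Subgroup G} {r s : ℕ} (h : NontorsionChain K r) (hs : s ≤ r) :
    NontorsionChain K s := by
  induction h generalizing s with
  | base K => obtain rfl : s = 0 := by omega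
              exact .base K
  | weaken _ hKL ih => exact (ih hs).weaken hKL
  | @step K L r h hKL hn x hx hxK ih =>
    rcases Nat.lt_or_ge s (r + 1) with h1 | h1
    · exact (ih (by omega)).weaken hKL
    · obtain rfl : s = r + 1 := by omega
      exact h.step hKL hn x hx hxK

/-- A chain in the image of `f` lifts and extends a chain in the kernel. -/
theorem comap_of_ker {f : G →* H} (hf : Function.Surjective f) {a b : ℕ}
    (ha : NontorsionChain f.ker a) {K : Subgroup H} (hb : NontorsionChain K b) :
    NontorsionChain (K.comap f) (a + b) := by
  induction hb with
  | base K => exact ha.weaken (Subgroup.ker_le_comap f K)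
  | weaken _ hKL ih => exact ih.weaken (Subgroup.comap_mono hKL)
  | @step K L r h hKL hn x hx hxK ih =>
    obtain ⟨y, rfl⟩ := hf x
    refine ih.step (Subgroup.comap_mono hKL) ?_ y hx ?_
    · intro g hg k hk
      simpa using hn _ hg _ hk
    · intro j hj hy
      exact hxK j hj (by simpa using hy)

theorem comap {f : G →* H} (hf : Function.Surjective f) {K : Subgroup H} {r : ℕ}
    (h : NontorsionChain K r) : NontorsionChain (K.comap f) r := by
  simpa using comap_of_ker hf (.base f.ker) h

theorem map {f : G →* H} (hf : Function.Injective f) {K : Subgroup G} {r : ℕ}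
    (h : NontorsionChain K r) : NontorsionChain (K.map f) r := by
  induction h with
  | base K => exact .base _
  | weaken _ hKL ih => exact ih.weaken (Subgroup.map_mono hKL)
  | @step K L r h hKL hn x hx hxK ih =>
    refine ih.step (Subgroup.map_mono hKL) ?_ (f x) (Subgroup.mem_map_of_mem f hx) ?_
    · rintro _ ⟨g, hg, rfl⟩ _ ⟨k, hk, rfl⟩
      exact ⟨_, hn g hg k hk, by simp⟩
    · rintro j hj ⟨k, hk, hkx⟩
      rw [← map_pow] at hkx
      exact hxK j hj (hf hkx ▸ hk)

theorem top_of_surjective {f : G →* H} (hf : Function.Surjective f) {r : ℕ}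
    (h : NontorsionChain (⊤ : Subgroup H) r) : NontorsionChain (⊤ : Subgroup G) r := by
  simpa using h.comap hf

theorem top_of_injective {f : G →* H} (hf : Function.Injective f) {r : ℕ}
    (h : NontorsionChain (⊤ : Subgroup G) r) : NontorsionChain (⊤ : Subgroup H) r :=
  (h.map hf).weaken le_top

theorem of_subgroup {K : Subgroup G} {r : ℕ} (h : NontorsionChain (⊤ : Subgroup K) r) :
    NontorsionChain K r := by
  have := h.map K.subtype_injective
  rwa [← MonoidHom.range_eq_map, Subgroup.range_subtype] at this

theorem subgroupOf {K L : Subgroup G} {r : ℕ} (h : NontorsionChain K r) (hL : K ≤ L) :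
    NontorsionChain (K.subgroupOf L) r := by
  induction h with
  | base K => exact .base _
  | weaken _ hKM ih => exact (ih (hKM.trans hL)).weaken (Subgroup.comap_mono hKM)
  | @step K M r h hKM hn x hx hxK ih =>
    refine (ih (hKM.trans hL)).step (Subgroup.comap_mono hKM) ?_ ⟨x, hL hx⟩ hx ?_
    · intro g hg c hc
      exact hn _ hg _ hc
    · intro j hj hmem
      exact hxK j hj (by simpa [Subgroup.mem_subgroupOf] using hmem)

theorem to_subgroup {K : Subgroup G} {r : ℕ} (h : NontorsionChain K r) :
    NontorsionChain (⊤ : Subgroup K) r :=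
  (h.subgroupOf le_rfl).weaken le_top

theorem top_add {N : Subgroup G} [N.Normal] {a b : ℕ} (ha : NontorsionChain N a)
    (hb : NontorsionChain (⊤ : Subgroup (G ⧸ N)) b) :
    NontorsionChain (⊤ : Subgroup G) (a + b) := by
  have := comap_of_ker (QuotientGroup.mk'_surjective N) (by simpa using ha) hb
  simpa using this

/-- A chain restricts to a chain in a normal subgroup and a chain in the quotient, without loss
of total length. -/
theorem split (f : G →* H) {K : Subgroup G} {r : ℕ} (h : NontorsionChain K r) :
    ∃ a b : ℕ, a + b = r ∧ NontorsionChain (K.subgroupOf f.ker) a ∧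
      NontorsionChain (K.map f) b := by
  induction h with
  | base K => exact ⟨0, 0, rfl, .base _, .base _⟩
  | weaken _ hKL ih =>
    obtain ⟨a, b, hab, ha, hb⟩ := ih
    exact ⟨a, b, hab, ha.weaken (Subgroup.comap_mono hKL),
      hb.weaken (Subgroup.map_mono hKL)⟩
  | @step K L r h hKL hn x hx hxK ih =>
    obtain ⟨a, b, hab, ha, hb⟩ := ih
    have hn' : ∀ g ∈ L.map f, ∀ k ∈ K.map f, g * k * g⁻¹ ∈ K.map f := by
      rintro _ ⟨g, hg, rfl⟩ _ ⟨k, hk, rfl⟩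
      exact ⟨_, hn g hg k hk, by simp⟩
    by_cases hpow : ∀ j : ℕ, 0 < j → (f x) ^ j ∉ K.map f
    · exact ⟨a, b + 1, by omega, ha.weaken (Subgroup.comap_mono hKL),
        hb.step (Subgroup.map_mono hKL) hn' (f x) (Subgroup.mem_map_of_mem f hx) hpow⟩
    · push Not at hpow
      obtain ⟨j, hj, k, hk, hkx⟩ := hpow
      -- When the step dies in the image, it survives in the kernel: by normality of `K` the powers
      -- of `k⁻¹ * x ^ j` agree modulo `K` with powers of `x ^ j`, so none of positive exponent
      -- falls into `K`.
      have hz : k⁻¹ * x ^ j ∈ f.ker := by simp [MonoidHom.mem_ker, hkx]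
      have hzL : k⁻¹ * x ^ j ∈ L := L.mul_mem (L.inv_mem (hKL hk)) (L.pow_mem hx j)
      refine ⟨a + 1, b, by omega, ha.step (Subgroup.comap_mono hKL) ?_
        ⟨_, hz⟩ hzL ?_, hb.weaken (Subgroup.map_mono hKL)⟩
      · intro g hg c hc
        exact hn _ hg _ hc
      · intro i hi hmem
        have hmem : (k⁻¹ * x ^ j) ^ i ∈ K := by
          simpa [Subgroup.mem_subgroupOf] using hmem
        have key : ∀ i : ℕ, ∃ c ∈ K, (k⁻¹ * x ^ j) ^ i = c * x ^ (j * i) := by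
          intro i
          induction i with
          | zero => exact ⟨1, K.one_mem, by simp⟩
          | succ i ihi =>
            obtain ⟨c, hc, hci⟩ := ihi
            refine ⟨c * (x ^ (j * i) * k⁻¹ * (x ^ (j * i))⁻¹),
              K.mul_mem hc (hn _ (L.pow_mem hx _) _ (K.inv_mem hk)), ?_⟩
            rw [pow_succ, hci, Nat.mul_succ, pow_add]
            group
        obtain ⟨c, hc, hci⟩ := key i
        rw [hci] at hmem
        exact hxK (j * i) (Nat.mul_pos hj hi) ((K.mul_mem_cancel_left hc).1 hmem)

theorem split_top (N : Subgroup G) [N.Normal] {r : ℕ}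
    (h : NontorsionChain (⊤ : Subgroup G) r) :
    ∃ a b : ℕ, a + b = r ∧ NontorsionChain (⊤ : Subgroup N) a ∧
      NontorsionChain (⊤ : Subgroup (G ⧸ N)) b := by
  obtain ⟨a, b, hab, ha, hb⟩ := h.split (QuotientGroup.mk' N)
  refine ⟨a, b, hab, ?_, hb.weaken le_top⟩
  have h1 := (ha.weaken le_top).top_of_surjective (f := (MulEquiv.subgroupCongr
    (QuotientGroup.ker_mk' N).symm).toMonoidHom) (MulEquiv.surjective _)
  exact h1

/-- A chain has only finitely many witnesses `x`, so one member of the family contains them all.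
Quantifying over all larger members lets the index grow during the induction. -/
theorem of_directed {ι : Type*} [Nonempty ι] {F : ι → Subgroup G} (hdir : Directed (· ≤ ·) F)
    (hsup : ⨆ i, F i = ⊤) {K : Subgroup G} {r : ℕ} (h : NontorsionChain K r) :
    ∃ i, ∀ j, F i ≤ F j → NontorsionChain (K.subgroupOf (F j)) r := by
  induction h with
  | base K => exact ⟨Classical.arbitrary ι, fun _ _ => .base _⟩
  | weaken _ hKL ih =>
    obtain ⟨i, hi⟩ := ih
    exact ⟨i, fun j hj => (hi j hj).weaken (Subgroup.comap_mono hKL)⟩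
  | @step K L r h hKL hn x hx hxK ih =>
    obtain ⟨i, hi⟩ := ih
    obtain ⟨i', hi'⟩ := (Subgroup.mem_iSup_of_directed hdir).1 (hsup ▸ Subgroup.mem_top x)
    obtain ⟨k, hik, hik'⟩ := hdir i i'
    refine ⟨k, fun j hj => (hi j (hik.trans hj)).step (Subgroup.comap_mono hKL) ?_
      ⟨x, hj (hik' hi')⟩ hx ?_⟩
    · intro g hg c hc
      exact hn _ hg _ hc
    · intro l hl hmem
      exact hxK l hl (by simpa [Subgroup.mem_subgroupOf] using hmem)

theorem eq_zero_of_finite [Finite G] {K : Subgroup G} {r : ℕ} (h : NontorsionChain K r) :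
    r = 0 := by
  induction h with
  | base K => rfl
  | weaken _ _ ih => exact ih
  | @step K L r h hKL hn x hx hxK ih =>
    exact absurd (by simp [K.one_mem]) (hxK (orderOf x) (orderOf_pos x))

/-- A nontrivial subgroup of ℤ has finite index, so no further step can start from it. The second
clause carries this through the induction. -/
theorem int_aux {K : Subgroup (Multiplicative ℤ)} {r : ℕ} (h : NontorsionChain K r) :
    r ≤ 1 ∧ (r = 1 → K ≠ ⊥) := by
  induction h with
  | base K => simp
  | weaken _ hKL ih =>
    refine ⟨ih.1, fun h1 h2 => ih.2 h1 ?_⟩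
    exact le_bot_iff.1 (h2 ▸ hKL)
  | @step K L r h hKL hn x hx hxK ih =>
    have hx1 : x ≠ 1 := by
      rintro rfl
      exact hxK 1 one_pos (by simp [K.one_mem])
    have hr : r ≠ 1 := by
      intro hr
      obtain ⟨y, hy, hy1⟩ := K.bot_or_exists_ne_one.resolve_left (ih.2 hr)
      have hy0 : Multiplicative.toAdd y ≠ 0 := hy1
      apply hxK (Multiplicative.toAdd y).natAbs (Int.natAbs_pos.2 hy0)
      have : ∃ e : ℤ, x ^ (Multiplicative.toAdd y).natAbs
          = y ^ e := by
        rcases Int.natAbs_eq (Multiplicative.toAdd y) with h | h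
        · refine ⟨Multiplicative.toAdd x, ?_⟩
          apply Multiplicative.toAdd.injective
          simp only [toAdd_pow, toAdd_zpow, smul_eq_mul, nsmul_eq_mul]
          rw [← h, mul_comm]
        · refine ⟨-Multiplicative.toAdd x, ?_⟩
          apply Multiplicative.toAdd.injective
          simp only [toAdd_pow, toAdd_zpow, smul_eq_mul, nsmul_eq_mul]
          rw [mul_comm, neg_mul, ← mul_neg, ← neg_eq_iff_eq_neg.2 h]
      obtain ⟨e, he⟩ := this
      rw [he]
      exact K.zpow_mem hy e
    refine ⟨by omega, fun _ hL => hx1 ?_⟩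
    simpa [hL] using hx

theorem of_nontorsion {K : Subgroup G} {x : G} (hx : x ∈ K)
    (hx' : ∀ j : ℕ, 0 < j → x ^ j ≠ 1) : NontorsionChain K 1 :=
  (base (⊥ : Subgroup G)).step bot_le (by simp) x hx (by simpa using hx')

end NontorsionChain

/-- Chains obey the same rules as Hirsch length: they split along extensions and descend to a member
of a directed union. With `HasHirschLength.chain_of_le` this makes the computed value unique. -/
theorem HasHirschLength.le_of_chain {G : Type u} [Group G] {n : ℕ∞} (h : HasHirschLength G n) :
    ∀ {r : ℕ}, NontorsionChain (⊤ : Subgroup G) r → (r : ℕ∞) ≤ n := by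
  induction h with
  | of_finite G => intro r hr; simp [hr.eq_zero_of_finite]
  | of_int e =>
    intro r hr
    have := (hr.top_of_surjective (f := e.toMonoidHom) e.surjective).int_aux.1
    exact_mod_cast this
  | of_mulEquiv e _ ih =>
    intro r hr
    exact ih (hr.top_of_surjective (f := e.toMonoidHom) e.surjective)
  | of_extension N _ _ ihN ihQ =>
    intro r hr
    obtain ⟨a, b, rfl, ha, hb⟩ := hr.split_top N
    push_cast
    exact add_le_add (ihN ha) (ihQ hb)
  | of_directed F hdir hsup n _ ih =>
    intro r hr
    obtain ⟨i, hi⟩ := hr.of_directed hdir hsup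
    exact (ih i ((hi i le_rfl).weaken le_top)).trans (le_iSup n i)

theorem HasHirschLength.chain_of_le {G : Type u} [Group G] {n : ℕ∞} (h : HasHirschLength G n) :
    ∀ {r : ℕ}, (r : ℕ∞) ≤ n → NontorsionChain (⊤ : Subgroup G) r := by
  induction h with
  | of_finite G =>
    intro r hr
    obtain rfl : r = 0 := by simpa using hr
    exact .base _
  | of_int e =>
    intro r hr
    have hr : r ≤ 1 := by exact_mod_cast hr
    refine NontorsionChain.mono ?_ hr
    refine .of_nontorsion (Subgroup.mem_top (e (Multiplicative.ofAdd 1))) fun j hj h => ?_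
    rw [← map_pow, map_eq_one_iff e e.injective, ← ofAdd_nsmul] at h
    have h : j • (1 : ℤ) = 0 := h
    simp at h
    omega
  | of_mulEquiv e _ ih =>
    intro r hr
    exact (ih hr).top_of_injective (f := e.toMonoidHom) e.injective
  | @of_extension G _ N _ a b _ _ ihN ihQ =>
    intro r hr
    obtain ⟨s, t, rfl, hs, ht⟩ : ∃ s t : ℕ, s + t = r ∧ (s : ℕ∞) ≤ a ∧ (t : ℕ∞) ≤ b := by
      induction a with
      | top => exact ⟨r, 0, rfl, le_top, zero_le⟩
      | coe a =>
        refine ⟨min r a, r - min r a, by omega, by exact_mod_cast min_le_right r a, ?_⟩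
        induction b with
        | top => exact le_top
        | coe b =>
          have : r ≤ a + b := by exact_mod_cast hr
          have : r - min r a ≤ b := by omega
          exact_mod_cast this
    exact (ihN hs).of_subgroup.top_add (ihQ ht)
  | @of_directed G _ ι _ F hdir hsup n _ ih =>
    intro r hr
    rcases Nat.eq_zero_or_pos r with rfl | hpos
    · exact .base _
    · obtain ⟨i, hi⟩ : ∃ i, (r : ℕ∞) ≤ n i := by
        by_contra! hcon
        have : ⨆ i, n i ≤ ((r - 1 : ℕ) : ℕ∞) := by
          refine iSup_le fun i => ?_
          have hi := hcon i
          have := hi.ne_top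
          lift n i to ℕ using this with k
          have : k < r := by exact_mod_cast hi
          have : k ≤ r - 1 := by omega
          exact_mod_cast this
        have := hr.trans this
        have : r ≤ r - 1 := by exact_mod_cast this
        omega
      exact (ih i hi).top_of_injective (F i).subtype_injective

/-! ### Finitely generated and locally finite subgroups -/

theorem Subgroup.exists_le_of_fg_of_directed {G : Type v} [Group G] {ι : Type*} [Nonempty ι]
    {F : ι → Subgroup G} (hdir : Directed (· ≤ ·) F) {H : Subgroup G} (hH : H.FG)
    (hle : H ≤ ⨆ i, F i) : ∃ i, H ≤ F i := by
  obtain ⟨S, rfl⟩ := hH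
  simp only [Subgroup.closure_le] at hle ⊢
  induction S using Finset.cons_induction with
  | empty => exact ⟨Classical.arbitrary ι, by simp⟩
  | cons a S ha ih =>
    rw [Finset.coe_cons, Set.insert_subset_iff] at hle
    obtain ⟨i, hi⟩ := ih hle.2
    obtain ⟨j, hj⟩ := (Subgroup.mem_iSup_of_directed hdir).1 hle.1
    obtain ⟨k, hik, hjk⟩ := hdir i j
    refine ⟨k, ?_⟩
    rw [Finset.coe_cons, Set.insert_subset_iff]
    exact ⟨hjk hj, fun x hx => hik (hi hx)⟩

theorem Subgroup.exists_fg_map_eq {G : Type v} [Group G] {H : Type w} [Group H] (f : G →* H)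
    {K : Subgroup G} {L : Subgroup H} (hL : L.FG) (hLK : L ≤ K.map f) :
    ∃ M ≤ K, M.FG ∧ M.map f = L := by
  classical
  obtain ⟨S, rfl⟩ := hL
  rw [Subgroup.closure_le] at hLK
  have hLK' : ∀ x : H, x ∈ S → ∃ y : G, y ∈ K ∧ f y = x := fun x hx => hLK hx
  choose! s hsK hs using hLK'
  refine ⟨Subgroup.closure (S.image s), ?_, ⟨_, rfl⟩, ?_⟩
  · rw [Subgroup.closure_le]
    simpa [Set.subset_def] using fun x hx => hsK x hx
  · rw [MonoidHom.map_closure, Finset.coe_image, Set.image_image]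
    congr 1
    ext x
    constructor
    · rintro ⟨y, hy, rfl⟩
      simpa only [hs y hy] using hy
    · exact fun hx => ⟨x, hx, hs x hx⟩

theorem Subgroup.FG.map_hom {G : Type v} [Group G] {H : Type w} [Group H] {K : Subgroup G}
    (hK : K.FG) (f : G →* H) : (K.map f).FG := by
  classical
  obtain ⟨S, rfl⟩ := hK
  exact ⟨S.image f, by simp [MonoidHom.map_closure]⟩

theorem IsCyclic.finite_or_mulEquiv_int {C : Type v} [Group C] [IsCyclic C] :
    Finite C ∨ Nonempty (Multiplicative ℤ ≃* C) := by
  obtain ⟨g, hg⟩ := IsCyclic.exists_generator (α := C)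
  rcases finite_or_infinite C with h | h
  · exact .inl h
  · exact .inr ⟨intEquivOfZPowersEqTop g (by rwa [Subgroup.eq_top_iff'])⟩

theorem HasHirschLength.exists_of_isCyclic (C : Type u) [Group C] [IsCyclic C] :
    ∃ n, HasHirschLength C n := by
  rcases IsCyclic.finite_or_mulEquiv_int (C := C) with h | ⟨⟨e⟩⟩
  · exact ⟨0, .of_finite C⟩
  · exact ⟨1, .of_int e⟩

/-- Allows the inductions on `HasHirschLength` to be applied to quotients; only the existence of
some value is needed there, bounds being supplied by chains. -/
theorem HasHirschLength.exists_of_surjective {G : Type u} [Group G] {n : ℕ∞}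
    (h : HasHirschLength G n) :
    ∀ {H : Type u} [Group H] (f : G →* H), Function.Surjective f → ∃ m, HasHirschLength H m := by
  induction h with
  | of_finite G =>
    intro H _ f hf
    have := Finite.of_surjective f hf
    exact ⟨0, .of_finite H⟩
  | of_int e =>
    intro H _ f hf
    have := isCyclic_of_surjective (f.comp e.toMonoidHom) (hf.comp e.surjective)
    exact exists_of_isCyclic H
  | of_mulEquiv e _ ih =>
    intro H _ f hf
    exact ih (f.comp e.toMonoidHom) (hf.comp e.surjective)
  | of_extension N _ _ ihN ihQ =>
    intro H _ f hf
    have : (N.map f).Normal := Subgroup.Normal.map ‹_› f hf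
    obtain ⟨a, ha⟩ := ihN (f.subgroupMap N) (f.subgroupMap_surjective N)
    obtain ⟨b, hb⟩ := ihQ (QuotientGroup.map N (N.map f) f (Subgroup.le_comap_map f N))
      (QuotientGroup.map_surjective_of_surjective _ _ _ (by
        exact (QuotientGroup.mk'_surjective _).comp hf) _)
    exact ⟨a + b, .of_extension _ ha hb⟩
  | of_directed F hdir hsup n _ ih =>
    intro H _ f hf
    choose m hm using fun i => ih i (f.subgroupMap (F i)) (f.subgroupMap_surjective (F i))
    have hdir' : Directed (· ≤ ·) fun i => (F i).map f := fun i j => by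
      obtain ⟨k, h1, h2⟩ := hdir i j
      exact ⟨k, Subgroup.map_mono h1, Subgroup.map_mono h2⟩
    refine ⟨_, .of_directed (fun i => (F i).map f) hdir' ?_ m hm⟩
    rw [← Subgroup.map_iSup, hsup, ← MonoidHom.range_eq_map, MonoidHom.range_eq_top.2 hf]

/-- A subgroup is locally finite if its finitely generated subgroups are finite. -/
def Subgroup.IsLocallyFinite {G : Type v} [Group G] (K : Subgroup G) : Prop :=
  ∀ H ≤ K, H.FG → Finite H

namespace Subgroup.IsLocallyFinite

variable {G : Type v} [Group G] {H : Type w} [Group H]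

theorem mono {K L : Subgroup G} (hL : L.IsLocallyFinite) (h : K ≤ L) : K.IsLocallyFinite :=
  fun M hM hfg => hL M (hM.trans h) hfg

theorem map {K : Subgroup G} (hK : K.IsLocallyFinite) (f : G →* H) :
    (K.map f).IsLocallyFinite := by
  intro L hL hfg
  obtain ⟨M, hMK, hM, rfl⟩ := Subgroup.exists_fg_map_eq f hfg hL
  have := hK M hMK hM
  exact Finite.of_surjective _ (f.subgroupMap_surjective M)

/-- A finitely generated `L` with finite image meets the kernel in a subgroup of finite index, which
is again finitely generated and hence finite. -/
theorem of_map_of_ker (f : G →* H) {K : Subgroup G} (h1 : (K.map f).IsLocallyFinite)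
    (h2 : (K ⊓ f.ker).IsLocallyFinite) : K.IsLocallyFinite := by
  intro L hL hfg
  have hfin : Finite (L.map f) := h1 _ (Subgroup.map_mono hL) (hfg.map_hom f)
  set g : L →* L.map f := f.subgroupMap L
  have : Group.FG L := (Group.fg_iff_subgroup_fg L).2 hfg
  have hidx : g.ker.FiniteIndex := by
    have : Finite g.range := inferInstance
    exact Subgroup.finiteIndex_ker g
  have hker : g.ker.FG := (Group.fg_iff_subgroup_fg _).1 inferInstance
  have hfin2 : Finite (g.ker.map L.subtype) := by
    refine h2 _ ?_ (hker.map_hom _)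
    rintro _ ⟨x, hx, rfl⟩
    refine ⟨hL x.2, ?_⟩
    have := congrArg Subtype.val (MonoidHom.mem_ker.1 hx)
    simpa [g] using this
  have hfin3 : Finite g.ker :=
    Finite.of_injective (fun x => (⟨L.subtype x, Subgroup.mem_map_of_mem _ x.2⟩ :
      g.ker.map L.subtype)) fun x y hxy => by
        apply Subtype.ext
        apply L.subtype_injective
        simpa using hxy
  have hq : Finite (L ⧸ g.ker) := Subgroup.finite_quotient_of_finiteIndex
  exact Finite.of_subgroup_quotient (H := g.ker)

theorem of_directed {ι : Type*} [Nonempty ι] {F : ι → Subgroup G} (hdir : Directed (· ≤ ·) F)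
    (hF : ∀ i, (F i).IsLocallyFinite) : (⨆ i, F i).IsLocallyFinite := by
  intro L hL hfg
  obtain ⟨i, hi⟩ := Subgroup.exists_le_of_fg_of_directed hdir hfg hL
  exact hF i L hi hfg

theorem isOfFinOrder {K : Subgroup G} (hK : K.IsLocallyFinite) {x : G} (hx : x ∈ K) :
    IsOfFinOrder x := by
  have := hK (Subgroup.zpowers x) (by simpa using hx) (Subgroup.fg_iff _ |>.2 ⟨{x}, by
    simp [Subgroup.zpowers_eq_closure]⟩)
  exact finite_zpowers.1 this

theorem of_finite [Finite G] (K : Subgroup G) : K.IsLocallyFinite := fun _ _ _ => inferInstance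

theorem of_comm {K : Subgroup G} (hcomm : ∀ x ∈ K, ∀ y ∈ K, x * y = y * x)
    (htors : ∀ x ∈ K, IsOfFinOrder x) : K.IsLocallyFinite := by
  intro L hL hfg
  have : Group.FG L := (Group.fg_iff_subgroup_fg L).2 hfg
  let _ : CommGroup L := { (inferInstance : Group L) with
    mul_comm := fun a b => Subtype.ext (hcomm _ (hL a.2) _ (hL b.2)) }
  exact CommGroup.finite_of_fg_isMulTorsion L fun x => by
    rw [← Submonoid.isOfFinOrder_coe]
    exact htors x (hL x.2)

/-- Schur: a group which is locally finite modulo a central subgroup has locally finite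
commutator subgroup. -/
theorem commutator_of_central {K : Subgroup G} (f : G →* H)
    (hc : ∀ x ∈ f.ker, ∀ y ∈ K, x * y = y * x) (hK : (K.map f).IsLocallyFinite) :
    (⁅K, K⁆ : Subgroup G).IsLocallyFinite := by
  classical
  have key : ∀ M ≤ K, M.FG → Finite (⁅M, M⁆ : Subgroup G) := by
    intro M hMK hM
    have hfin : Finite (M.map f) := hK _ (Subgroup.map_mono hMK) (hM.map_hom f)
    set g : M →* M.map f := f.subgroupMap M
    have hcen : g.ker ≤ Subgroup.center M := by
      intro x hx
      rw [Subgroup.mem_center_iff]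
      intro y
      apply Subtype.ext
      refine (hc x ?_ y (hMK y.2)).symm
      have := congrArg Subtype.val (MonoidHom.mem_ker.1 hx)
      simpa [g] using this
    -- A commutator depends only on the classes of its entries modulo the center, so there are
    -- finitely many; Schur's theorem then makes the commutator subgroup finite.
    have hset : Finite (commutatorSet M) := by
      choose s hs using f.subgroupMap_surjective M
      have hsub : commutatorSet M ⊆
          Set.range fun p : M.map f × M.map f =>
            s p.1 * s p.2 * (s p.1)⁻¹ * (s p.2)⁻¹ := by
        rintro _ ⟨x, y, rfl⟩
        refine ⟨(g x, g y), ?_⟩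
        have h1 : ∀ z : M, (s (g z))⁻¹ * z ∈ Subgroup.center M := fun z => hcen (by
          rw [MonoidHom.mem_ker, map_mul, map_inv]
          have := hs (g z)
          change (g (s (g z)))⁻¹ * g z = 1
          rw [show g (s (g z)) = g z from this]; simp)
        obtain ⟨a, ha, hxa⟩ : ∃ a ∈ Subgroup.center M, x = s (g x) * a :=
          ⟨_, h1 x, by group⟩
        obtain ⟨b, hb, hyb⟩ : ∃ b ∈ Subgroup.center M, y = s (g y) * b :=
          ⟨_, h1 y, by group⟩
        rw [Subgroup.mem_center_iff] at ha hb
        set p := s (g x)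
        set q := s (g y)
        change p * q * p⁻¹ * q⁻¹ = x * y * x⁻¹ * y⁻¹
        rw [hxa, hyb]
        simp only [mul_inv_rev]
        have e1 : p * a * (q * b) * (a⁻¹ * p⁻¹) * (b⁻¹ * q⁻¹)
            = p * q * (a * b * a⁻¹) * p⁻¹ * b⁻¹ * q⁻¹ := by
          rw [mul_assoc p a, ← mul_assoc a q b, ← ha q]; group
        rw [e1, ← ha b]
        have e2 : p * q * (b * a * a⁻¹) * p⁻¹ * b⁻¹ * q⁻¹
            = p * q * (b * p⁻¹) * b⁻¹ * q⁻¹ := by group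
        rw [e2, ← hb p⁻¹]
        group
      exact (Set.finite_range _).subset hsub
    have : Finite (_root_.commutator M) := inferInstance
    have h2 : (⁅M, M⁆ : Subgroup G) = (_root_.commutator M).map M.subtype := by
      rw [_root_.commutator_def, Subgroup.map_commutator, ← MonoidHom.range_eq_map,
        Subgroup.range_subtype]
    rw [h2]
    exact Finite.of_surjective _ (M.subtype.subgroupMap_surjective (_root_.commutator M))
  intro L hL hfg
  have hdirM : Directed (· ≤ ·) fun M : {M : Subgroup G // M ≤ K ∧ M.FG} => ⁅M.1, M.1⁆ := by
    rintro ⟨M, hM1, hM2⟩ ⟨N, hN1, hN2⟩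
    exact ⟨⟨M ⊔ N, sup_le hM1 hN1, hM2.sup hN2⟩,
      Subgroup.commutator_mono le_sup_left le_sup_left,
      Subgroup.commutator_mono le_sup_right le_sup_right⟩
  have : Nonempty {M : Subgroup G // M ≤ K ∧ M.FG} := ⟨⟨⊥, bot_le, Subgroup.FG.bot⟩⟩
  obtain ⟨⟨M, hM1, hM2⟩, hLM⟩ := Subgroup.exists_le_of_fg_of_directed hdirM hfg (by
    refine hL.trans ?_
    rw [Subgroup.commutator_le]
    intro x hx y hy
    refine (Subgroup.mem_iSup_of_directed hdirM).2 ⟨⟨Subgroup.closure {x, y}, ?_, ?_⟩, ?_⟩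
    · rw [Subgroup.closure_le]
      rintro z (rfl | rfl)
      · exact hx
      · exact hy
    · exact ⟨{x, y}, by simp⟩
    · exact Subgroup.commutator_mem_commutator (Subgroup.subset_closure (by simp))
        (Subgroup.subset_closure (by simp)))
  have := key M hM1 hM2
  exact Finite.of_injective _ (Subgroup.inclusion_injective hLM)

end Subgroup.IsLocallyFinite

/-- Hirsch length zero amounts to local finiteness: the infinite cyclic group is excluded, and
extensions and directed unions preserve local finiteness. -/
theorem HasHirschLength.isLocallyFinite_top {G : Type u} [Group G] {n : ℕ∞}
    (h : HasHirschLength G n) :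
    ¬ NontorsionChain (⊤ : Subgroup G) 1 → (⊤ : Subgroup G).IsLocallyFinite := by
  induction h with
  | of_finite G => exact fun _ => .of_finite _
  | of_int e =>
    intro h
    exact absurd ((HasHirschLength.of_int e).chain_of_le (r := 1) le_rfl) h
  | of_mulEquiv e _ ih =>
    intro h
    have := (ih fun h' => h (h'.top_of_injective (f := e.toMonoidHom) e.injective)).map
      e.toMonoidHom
    rwa [← MonoidHom.range_eq_map, MonoidHom.range_eq_top.2 e.surjective] at this
  | of_extension N _ _ ihN ihQ =>
    intro h
    have h1 := ihN fun h' => h (h'.top_of_injective N.subtype_injective)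
    have h2 := ihQ fun h' => h (h'.top_of_surjective (QuotientGroup.mk'_surjective N))
    refine Subgroup.IsLocallyFinite.of_map_of_ker (QuotientGroup.mk' N) (h2.mono le_top) ?_
    have := h1.map N.subtype
    rw [← MonoidHom.range_eq_map, Subgroup.range_subtype] at this
    simpa using this
  | of_directed F hdir hsup n _ ih =>
    intro h
    rw [← hsup]
    refine .of_directed hdir fun i => ?_
    have := (ih i fun h' => h (h'.top_of_injective (F i).subtype_injective)).map (F i).subtype
    rwa [← MonoidHom.range_eq_map, Subgroup.range_subtype] at this

/-! ### Derived series of directed unions -/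

section derivedSeries

variable {G : Type v} [Group G]

theorem derivedSeries_map_subtype_succ (K : Subgroup G) (n : ℕ) :
    (derivedSeries K (n + 1)).map K.subtype =
      ⁅(derivedSeries K n).map K.subtype, (derivedSeries K n).map K.subtype⁆ := by
  rw [derivedSeries_succ, Subgroup.map_commutator]

theorem derivedSeries_map_subtype_mono {K L : Subgroup G} (h : K ≤ L) (n : ℕ) :
    (derivedSeries K n).map K.subtype ≤ (derivedSeries L n).map L.subtype := by
  induction n with
  | zero => simpa [← MonoidHom.range_eq_map] using h
  | succ n ih =>
    rw [derivedSeries_map_subtype_succ, derivedSeries_map_subtype_succ]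
    exact Subgroup.commutator_mono ih ih

theorem directed_derivedSeries_map {ι : Type*} {F : ι → Subgroup G}
    (hdir : Directed (· ≤ ·) F) (n : ℕ) :
    Directed (· ≤ ·) fun i => (derivedSeries (F i) n).map (F i).subtype := fun i j => by
  obtain ⟨k, hik, hjk⟩ := hdir i j
  exact ⟨k, derivedSeries_map_subtype_mono hik n, derivedSeries_map_subtype_mono hjk n⟩

theorem derivedSeries_le_iSup {ι : Type*} [Nonempty ι] {F : ι → Subgroup G}
    (hdir : Directed (· ≤ ·) F) (hsup : ⨆ i, F i = ⊤) (n : ℕ) :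
    derivedSeries G n ≤ ⨆ i, (derivedSeries (F i) n).map (F i).subtype := by
  induction n with
  | zero => simp [← MonoidHom.range_eq_map, hsup]
  | succ n ih =>
    rw [derivedSeries_succ, Subgroup.commutator_le]
    intro x hx y hy
    obtain ⟨i, hi⟩ := (Subgroup.mem_iSup_of_directed (directed_derivedSeries_map hdir n)).1 (ih hx)
    obtain ⟨j, hj⟩ := (Subgroup.mem_iSup_of_directed (directed_derivedSeries_map hdir n)).1 (ih hy)
    obtain ⟨k, hik, hjk⟩ := directed_derivedSeries_map hdir n i j
    refine (Subgroup.mem_iSup_of_directed (directed_derivedSeries_map hdir (n + 1))).2 ⟨k, ?_⟩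
    rw [derivedSeries_map_subtype_succ]
    exact Subgroup.commutator_mem_commutator (hik hi) (hjk hj)

/-- An iterated commutator involves finitely many elements; this reduces a locally finite action to
a finite one. -/
theorem exists_fg_mem_derivedSeries {n : ℕ} {x : G} (hx : x ∈ derivedSeries G n) :
    ∃ H : Subgroup G, H.FG ∧ x ∈ (derivedSeries H n).map H.subtype := by
  have hdir : Directed (· ≤ ·) fun H : {H : Subgroup G // H.FG} => H.1 := fun H K =>
    ⟨⟨H.1 ⊔ K.1, H.2.sup K.2⟩, le_sup_left, le_sup_right⟩
  have : Nonempty {H : Subgroup G // H.FG} := ⟨⟨⊥, .bot⟩⟩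
  have hsup : ⨆ H : {H : Subgroup G // H.FG}, H.1 = ⊤ := by
    rw [eq_top_iff]
    intro y _
    exact (Subgroup.mem_iSup_of_directed hdir).2
      ⟨⟨Subgroup.closure {y}, ⟨{y}, by simp⟩⟩, Subgroup.subset_closure rfl⟩
  obtain ⟨H, hH⟩ := (Subgroup.mem_iSup_of_directed (directed_derivedSeries_map hdir n)).1
    (derivedSeries_le_iSup hdir hsup n hx)
  exact ⟨H.1, H.2, hH⟩

end derivedSeries

/-! ### Torsion-free abelian normal subgroups of rank one -/

section TorsionFreeAbelian

variable {G : Type v} [Group G]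

/-- A subgroup which is abelian and torsion-free. -/
structure Subgroup.IsTorsionFreeAbelian (B : Subgroup G) : Prop where
  comm : ∀ x ∈ B, ∀ y ∈ B, x * y = y * x
  eq_one : ∀ x ∈ B, ∀ j : ℕ, 0 < j → x ^ j = 1 → x = 1

namespace Subgroup.IsTorsionFreeAbelian

variable {B : Subgroup G}

theorem eq_one_of_zpow (hB : B.IsTorsionFreeAbelian) {x : G} (hx : x ∈ B) {j : ℤ} (hj : j ≠ 0)
    (h : x ^ j = 1) : x = 1 := by
  refine hB.eq_one x hx j.natAbs (Int.natAbs_pos.2 hj) ?_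
  rcases Int.natAbs_eq j with h' | h'
  · rw [h', zpow_natCast] at h
    exact h
  · rw [h', zpow_neg, zpow_natCast, inv_eq_one] at h
    exact h

theorem eq_of_zpow (hB : B.IsTorsionFreeAbelian) {x y : G} (hx : x ∈ B) (hy : y ∈ B) {j : ℤ}
    (hj : j ≠ 0) (h : x ^ j = y ^ j) : x = y := by
  have h1 : (x * y⁻¹) ^ j = 1 := by
    have hc : Commute x y⁻¹ := hB.comm x hx _ (B.inv_mem hy)
    rw [hc.mul_zpow, h, inv_zpow, mul_inv_cancel]
  exact mul_inv_eq_one.1 (hB.eq_one_of_zpow (B.mul_mem hx (B.inv_mem hy)) hj h1)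

theorem chain_one (hB : B.IsTorsionFreeAbelian) (hne : B ≠ ⊥) : NontorsionChain B 1 := by
  obtain ⟨x, hx, hx1⟩ := B.bot_or_exists_ne_one.resolve_left hne
  exact .of_nontorsion hx fun j hj h => hx1 (hB.eq_one x hx j hj h)

/-- Otherwise the subgroups 1 < ⟨b⟩ < `B` would give a chain of length two, with `c` as the second
witness. -/
theorem exists_pow_eq_zpow (hB : B.IsTorsionFreeAbelian) (h2 : ¬ NontorsionChain B 2) {b c : G}
    (hb : b ∈ B) (hb1 : b ≠ 1) (hc : c ∈ B) : ∃ i : ℕ, 0 < i ∧ ∃ j : ℤ, c ^ i = b ^ j := by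
  by_contra! hcon
  refine h2 ((NontorsionChain.of_nontorsion (Subgroup.mem_zpowers b)
    fun j hj h => hb1 (hB.eq_one b hb j hj h)).step (by simpa using hb) ?_ c hc ?_)
  · intro g hg k hk
    have hkB : k ∈ B := (Subgroup.zpowers_le.2 hb) hk
    rw [hB.comm g hg k hkB]
    simpa using hk
  · rintro j hj ⟨e, he⟩
    exact hcon j hj e he.symm

/-- On a group of rank one every automorphism is multiplication by a rational number, so any two
conjugation actions commute. -/
theorem commutator_le_centralizer (hB : B.IsTorsionFreeAbelian) [B.Normal]
    (h2 : ¬ NontorsionChain B 2) : derivedSeries G 1 ≤ Subgroup.centralizer (B : Set G) := by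
  rw [derivedSeries_one, _root_.commutator_def, Subgroup.commutator_le]
  intro g _ h _
  rw [Subgroup.mem_centralizer_iff]
  intro b hb
  by_cases hb1 : b = 1
  · simp [hb1]
  have hconj : ∀ g : G, ∀ c ∈ B, g * c * g⁻¹ ∈ B := fun g c hc =>
    Subgroup.Normal.conj_mem ‹_› c hc g
  obtain ⟨i, hi, j, hij⟩ := hB.exists_pow_eq_zpow h2 hb hb1 (hconj g⁻¹ b hb)
  obtain ⟨k, hk, l, hkl⟩ := hB.exists_pow_eq_zpow h2 hb hb1 (hconj h⁻¹ b hb)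
  -- If `p` acts as j/i and `q` as l/k, then `p * q` acts as jl/(ik). This is symmetric in the two,
  -- and uniqueness of roots turns it into equality of the conjugates.
  have key : ∀ (p q : G) (i k : ℕ) (j l : ℤ), (p * b * p⁻¹) ^ i = b ^ j →
      (q * b * q⁻¹) ^ k = b ^ l → (p * (q * b * q⁻¹) * p⁻¹) ^ ((i * k : ℕ) : ℤ) = b ^ (j * l) := by
    intro p q i k j l h1 h2
    rw [zpow_natCast, mul_comm i k, pow_mul, conj_pow, h2, ← conj_zpow, ← zpow_natCast,
      ← zpow_mul, mul_comm l, zpow_mul, zpow_natCast, h1, zpow_mul]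
  have e : g⁻¹ * (h⁻¹ * b * h⁻¹⁻¹) * g⁻¹⁻¹ = h⁻¹ * (g⁻¹ * b * g⁻¹⁻¹) * h⁻¹⁻¹ := by
    refine hB.eq_of_zpow (hconj _ _ (hconj _ _ hb)) (hconj _ _ (hconj _ _ hb))
      (j := ((i * k : ℕ) : ℤ)) (by positivity) ?_
    rw [key g⁻¹ h⁻¹ i k j l hij hkl, mul_comm i k, key h⁻¹ g⁻¹ k i l j hkl hij, mul_comm]
  rw [commutatorElement_def]
  have e' : h⁻¹ * g⁻¹ * b * g * h = g⁻¹ * h⁻¹ * b * h * g := by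
    simpa only [mul_assoc, inv_inv] using e.symm
  calc b * (g * h * g⁻¹ * h⁻¹)
      = g * h * (h⁻¹ * g⁻¹ * b * g * h) * g⁻¹ * h⁻¹ := by group
    _ = g * h * g⁻¹ * h⁻¹ * b := by rw [e']; group

end Subgroup.IsTorsionFreeAbelian

/-- If a normal subgroup is not locally finite, but some term of its derived series is, then
modulo a locally finite normal subgroup there is a nontrivial torsion-free abelian normal
subgroup. -/
theorem exists_isTorsionFreeAbelian_quotient {G : Type u} [Group G] (N : Subgroup G) [N.Normal]
    (hN : ¬ N.IsLocallyFinite) {d : ℕ}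
    (hd : ((derivedSeries N d).map N.subtype).IsLocallyFinite) :
    ∃ (E : Type u) (_ : Group E) (f : G →* E), Function.Surjective f ∧ f.ker.IsLocallyFinite ∧
      ∃ B : Subgroup E, B.Normal ∧ B.IsTorsionFreeAbelian ∧ B ≠ ⊥ := by
  -- At the last derived subgroup S that is not locally finite, S/[S,S] is abelian and not torsion;
  -- dividing out [S,S] and then the torsion leaves the required subgroup.
  obtain ⟨k, hk, hk1⟩ : ∃ k, ¬ ((derivedSeries N k).map N.subtype).IsLocallyFinite ∧
      ((derivedSeries N (k + 1)).map N.subtype).IsLocallyFinite := by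
    by_contra! hcon
    have : ∀ k, ¬ ((derivedSeries N k).map N.subtype).IsLocallyFinite := by
      intro k
      induction k with
      | zero => simpa [← MonoidHom.range_eq_map] using hN
      | succ k ih => exact hcon k ih
    exact this d hd
  set S := (derivedSeries N k).map N.subtype
  set M := (derivedSeries N (k + 1)).map N.subtype with hM
  have hMS : M = ⁅S, S⁆ := derivedSeries_map_subtype_succ N k
  have : S.Normal := inferInstance
  have : M.Normal := inferInstance
  set p := QuotientGroup.mk' M
  have hp : Function.Surjective p := QuotientGroup.mk'_surjective M
  have hcomm : ∀ x ∈ S.map p, ∀ y ∈ S.map p, x * y = y * x := by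
    rintro _ ⟨x, hx, rfl⟩ _ ⟨y, hy, rfl⟩
    rw [← map_mul, ← map_mul]
    refine QuotientGroup.eq.2 ?_
    have h1 := Subgroup.commutator_mem_commutator (S.inv_mem hy) (S.inv_mem hx)
    rw [← hMS] at h1
    simpa [commutatorElement_def, mul_assoc] using h1
  have hSn : (S.map p).Normal := Subgroup.Normal.map ‹_› p hp
  let T : Subgroup (G ⧸ M) :=
    { carrier := {x | x ∈ S.map p ∧ IsOfFinOrder x}
      mul_mem' := fun {a b} ha hb => ⟨mul_mem ha.1 hb.1,
        (show Commute a b from hcomm a ha.1 b hb.1).isOfFinOrder_mul ha.2 hb.2⟩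
      one_mem' := ⟨one_mem _, .one⟩
      inv_mem' := fun {a} ha => ⟨inv_mem ha.1, ha.2.inv⟩ }
  have hTn : T.Normal := ⟨fun x hx g => ⟨hSn.conj_mem x hx.1 g, by
    have := (MulAut.conj g).toMonoidHom.isOfFinOrder hx.2
    simpa using this⟩⟩
  have hT : T.IsLocallyFinite :=
    .of_comm (fun x hx y hy => hcomm x hx.1 y hy.1) fun x hx => hx.2
  set q := QuotientGroup.mk' T
  refine ⟨(G ⧸ M) ⧸ T, inferInstance, q.comp p,
    (QuotientGroup.mk'_surjective T).comp hp, ?_, (S.map p).map q,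
    hSn.map q (QuotientGroup.mk'_surjective T), ⟨?_, ?_⟩, ?_⟩
  · refine Subgroup.IsLocallyFinite.of_map_of_ker p (hT.mono ?_) (hk1.mono ?_)
    · rintro _ ⟨x, hx, rfl⟩
      simpa [MonoidHom.mem_ker, q, QuotientGroup.eq_one_iff] using hx
    · simp [p]
  · rintro _ ⟨x, hx, rfl⟩ _ ⟨y, hy, rfl⟩
    rw [← map_mul, ← map_mul, hcomm x hx y hy]
  · rintro _ ⟨x, hx, rfl⟩ j hj h
    rw [← map_pow] at h
    have h1 : x ^ j ∈ T := (QuotientGroup.eq_one_iff _).1 h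
    exact (QuotientGroup.eq_one_iff x).2 ⟨hx, (isOfFinOrder_pow.1 h1.2).resolve_right hj.ne'⟩
  · intro hbot
    rw [Subgroup.map_eq_bot_iff] at hbot
    apply hk
    refine Subgroup.IsLocallyFinite.of_map_of_ker p (hT.mono ?_) (hk1.mono ?_)
    · simpa [q] using hbot
    · simp [p]

end TorsionFreeAbelian

/-! ### Finite groups of integral matrices of size at most two -/

section FiniteMatrixGroups

open Matrix

/-- Two matrices which commute with a non-scalar `2 × 2` matrix commute with each other. -/
theorem Matrix.commute_of_commute_fin_two {K g h : Matrix (Fin 2) (Fin 2) ℤ} (hK : K 1 0 ≠ 0)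
    (hg : g * K = K * g) (hh : h * K = K * h) : g * h = h * g := by
  have e : ∀ {g : Matrix (Fin 2) (Fin 2) ℤ}, g * K = K * g →
      g 0 1 * K 1 0 = K 0 1 * g 1 0 ∧
      g 1 0 * K 0 0 + g 1 1 * K 1 0 = K 1 0 * g 0 0 + K 1 1 * g 1 0 := by
    intro g hg
    have h00 := congrFun (congrFun hg 0) 0
    have h10 := congrFun (congrFun hg 1) 0
    simp only [Matrix.mul_apply, Fin.sum_univ_two] at h00 h10
    exact ⟨by linarith, h10⟩
  obtain ⟨g1, g2⟩ := e hg
  obtain ⟨h1, h2⟩ := e hh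
  ext i j
  fin_cases i <;> fin_cases j <;> simp [Matrix.mul_apply, Fin.sum_univ_two] <;>
    refine mul_right_cancel₀ hK ?_
  · linear_combination h 1 0 * g1 - g 1 0 * h1
  -- The upper right entry needs a second factor `K 1 0`, because each of the relations for `g` and
  -- `h` clears only one denominator.
  · apply mul_right_cancel₀ hK
    linear_combination (g 0 0 * K 1 0 - g 1 1 * K 1 0) * h1 +
      (h 1 1 * K 1 0 - h 0 0 * K 1 0) * g1 + K 0 1 * g 1 0 * h2 - K 0 1 * h 1 0 * g2
  · linear_combination h 1 0 * g2 - g 1 0 * h2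
  · linear_combination g 1 0 * h1 - h 1 0 * g1

/-- A finite matrix group preserves the positive definite form P = ∑ MᵀM, and a matrix of
determinant one preserves the symplectic form J. So these matrices commute with JP, which is not
scalar because its lower left entry is -P₀₀, and the centralizer of such a matrix is commutative. -/
theorem Matrix.commute_of_finite_range_of_det_eq_one {H : Type v} [Group H]
    (ρ : H →* Matrix (Fin 2) (Fin 2) ℤ) (hfin : (Set.range ρ).Finite) {g h : H}
    (hg : (ρ g).det = 1) (hh : (ρ h).det = 1) : ρ g * ρ h = ρ h * ρ g := by
  set P : Matrix (Fin 2) (Fin 2) ℤ := ∑ M ∈ hfin.toFinset, Mᵀ * M with hP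
  have hinv : ∀ g : H, (ρ g)ᵀ * P * ρ g = P := by
    intro g
    rw [hP, Finset.mul_sum, Finset.sum_mul]
    refine Finset.sum_bij (fun M _ => M * ρ g) ?_ ?_ ?_ ?_
    · intro M hM
      simp only [Set.Finite.mem_toFinset, Set.mem_range] at hM ⊢
      obtain ⟨k, rfl⟩ := hM
      exact ⟨k * g, map_mul _ _ _⟩
    · intro M _ N _ hMN
      have := congrArg (· * ρ g⁻¹) hMN
      simpa [mul_assoc, ← map_mul] using this
    · intro M hM
      simp only [Set.Finite.mem_toFinset, Set.mem_range] at hM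
      obtain ⟨k, rfl⟩ := hM
      exact ⟨ρ (k * g⁻¹), by simp only [Set.Finite.mem_toFinset, Set.mem_range_self], by
        rw [← map_mul]; simp⟩
    · intro M _
      simp [Matrix.transpose_mul, Matrix.mul_assoc]
  have hpos : 0 < P 0 0 := by
    have hsq : ∀ M : Matrix (Fin 2) (Fin 2) ℤ, (Mᵀ * M) 0 0 = M 0 0 ^ 2 + M 1 0 ^ 2 := by
      intro M
      simp [Matrix.mul_apply, Fin.sum_univ_two, sq]
    have h1 : P 0 0 = ∑ M ∈ hfin.toFinset, (M 0 0 ^ 2 + M 1 0 ^ 2) := by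
      rw [hP, Matrix.sum_apply]
      exact Finset.sum_congr rfl fun M _ => hsq M
    rw [h1]
    refine Finset.sum_pos' (fun M _ => by positivity) ⟨1, ?_, by simp⟩
    simp only [Set.Finite.mem_toFinset, Set.mem_range]
    exact ⟨1, map_one ρ⟩
  set J : Matrix (Fin 2) (Fin 2) ℤ := !![0, 1; -1, 0]
  have hJ : ∀ A : Matrix (Fin 2) (Fin 2) ℤ, A.det = 1 → A * J * Aᵀ = J := by
    intro A hA
    rw [Matrix.det_fin_two] at hA
    ext i j
    fin_cases i <;> fin_cases j <;>
      simp [J, Matrix.mul_apply, Fin.sum_univ_two] <;> linarith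
  have hcomm : ∀ g : H, (ρ g).det = 1 → ρ g * (J * P) = J * P * ρ g := by
    intro g hg
    calc ρ g * (J * P) = ρ g * J * ((ρ g)ᵀ * P * ρ g) := by rw [hinv, Matrix.mul_assoc]
      _ = ρ g * J * (ρ g)ᵀ * P * ρ g := by simp only [Matrix.mul_assoc]
      _ = J * P * ρ g := by rw [hJ _ hg]
  refine Matrix.commute_of_commute_fin_two ?_ (hcomm g hg) (hcomm h hh)
  simp [J, Matrix.mul_apply, Fin.sum_univ_two]
  exact hpos.ne'

theorem Matrix.det_eq_one_of_mem_commutator {H : Type v} [Group H] {r : ℕ}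
    (ρ : H →* Matrix (Fin r) (Fin r) ℤ) {g : H} (hg : g ∈ derivedSeries H 1) :
    (ρ g).det = 1 := by
  rw [derivedSeries_one] at hg
  have := Abelianization.commutator_subset_ker
    ((Units.map Matrix.detMonoidHom).comp ρ.toHomUnits) hg
  have := congrArg Units.val (MonoidHom.mem_ker.1 this)
  simpa using this

theorem Matrix.eq_one_of_mem_derivedSeries_two {H : Type v} [Group H] {r : ℕ} (hr : r ≤ 2)
    (ρ : H →* Matrix (Fin r) (Fin r) ℤ) (hfin : (Set.range ρ).Finite) {g : H}
    (hg : g ∈ derivedSeries H 2) : ρ g = 1 := by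
  interval_cases r
  · exact Subsingleton.elim _ _
  · have := Matrix.det_eq_one_of_mem_commutator ρ (derivedSeries_antitone H one_le_two hg)
    ext i j
    fin_cases i
    fin_cases j
    simpa using this
  · have hle : derivedSeries H 2 ≤ ρ.ker := by
      rw [derivedSeries_succ, Subgroup.commutator_le]
      intro x hx y hy
      have hc := Matrix.commute_of_finite_range_of_det_eq_one ρ hfin
        (Matrix.det_eq_one_of_mem_commutator ρ hx) (Matrix.det_eq_one_of_mem_commutator ρ hy)
      rw [MonoidHom.mem_ker, commutatorElement_def, map_mul, map_mul, map_mul, hc,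
        mul_assoc (ρ y), ← map_mul, mul_inv_cancel, map_one, mul_one, ← map_mul, mul_inv_cancel,
        map_one]
    exact hle hg

end FiniteMatrixGroups

/-! ### Free abelian groups of finite rank -/

section Lattices

theorem NontorsionChain.multiplicative_pi (r : ℕ) :
    NontorsionChain (⊤ : Subgroup (Multiplicative (Fin r → ℤ))) r := by
  -- The coordinate flag: `K i` consists of the vectors supported on the first `i` coordinates.
  let K : ℕ → Subgroup (Multiplicative (Fin r → ℤ)) := fun i =>
    { carrier := {f | ∀ j : Fin r, i ≤ j → Multiplicative.toAdd f j = 0}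
      mul_mem' := fun {a b} ha hb j hj => by
        rw [toAdd_mul, Pi.add_apply, ha j hj, hb j hj, add_zero]
      one_mem' := fun j _ => rfl
      inv_mem' := fun {a} ha j hj => by rw [toAdd_inv, Pi.neg_apply, ha j hj, neg_zero] }
  have key : ∀ i ≤ r, NontorsionChain (K i) i := by
    intro i hi
    induction i with
    | zero => exact .base _
    | succ i ih =>
      refine (ih (by omega)).step (fun f hf j hj => hf j (by omega)) ?_
        (Multiplicative.ofAdd (Pi.single ⟨i, hi⟩ 1)) ?_ ?_
      · intro g _ k hk
        rwa [mul_comm g k, mul_inv_cancel_right]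
      · intro j hj
        rw [toAdd_ofAdd, Pi.single_eq_of_ne]
        rintro rfl
        simp at hj
      · intro j hj h
        have := h ⟨i, hi⟩ le_rfl
        simp at this
        omega
  exact (key r le_rfl).weaken le_top

theorem NontorsionChain.two_le_of_pi {r : ℕ}
    (h : NontorsionChain (⊤ : Subgroup (Multiplicative (Fin r → ℤ))) 2) : 2 ≤ r := by
  by_contra! hr
  interval_cases r
  · have : Finite (Multiplicative (Fin 0 → ℤ)) := inferInstanceAs (Finite (Fin 0 → ℤ))
    exact absurd h.eq_zero_of_finite (by norm_num)
  · let e : (Fin 1 → ℤ) ≃+ ℤ := (LinearEquiv.funUnique (Fin 1) ℤ ℤ).toAddEquiv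
    have := (h.top_of_injective (f := (AddEquiv.toMultiplicative e).toMonoidHom)
      (AddEquiv.toMultiplicative e).injective).int_aux.1
    omega

/-- A finitely generated torsion-free abelian group is free abelian. -/
theorem CommGroup.exists_mulEquiv_pi (A : Type v) [CommGroup A] [Group.FG A]
    (htf : ∀ x : A, ∀ j : ℕ, 0 < j → x ^ j = 1 → x = 1) :
    ∃ r : ℕ, Nonempty (A ≃* Multiplicative (Fin r → ℤ)) := by
  have : Module.Finite ℤ (Additive A) := Module.Finite.iff_addGroup_fg.2 inferInstance
  have : IsAddTorsionFree (Additive A) := by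
    refine ⟨fun n hn x y hxy => ?_⟩
    have h1 : (x.toMul / y.toMul) ^ n = 1 := by
      rw [div_pow, div_eq_one]
      exact hxy
    exact Additive.toMul.injective (div_eq_one.1 (htf _ n (Nat.pos_of_ne_zero hn) h1))
  have : Module.IsTorsionFree ℤ (Additive A) := inferInstance
  have : Module.Free ℤ (Additive A) := inferInstance
  let b := Module.finBasis ℤ (Additive A)
  exact ⟨_, ⟨(AddEquiv.toMultiplicativeRight b.equivFun.toAddEquiv)⟩⟩

end Lattices

/-! ### Locally finite actions on abelian groups of rank at most two -/

namespace Subgroup.IsTorsionFreeAbelian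

variable {G : Type v} [Group G] {B : Subgroup G}

/-- A group which acts by conjugation through a finite group on a torsion-free abelian normal
subgroup of rank at most two acts through a metabelian group. -/
theorem commute_of_mem_derivedSeries_two (hB : B.IsTorsionFreeAbelian) [B.Normal]
    (h3 : ¬ NontorsionChain B 3) {H : Subgroup G}
    (hfin : Finite (H.map (QuotientGroup.mk' B))) {h : H} (hh : h ∈ derivedSeries H 2) {b : G}
    (hb : b ∈ B) : (h : G) * b = b * h := by
  set p := QuotientGroup.mk' B
  have hconj : ∀ g : G, ∀ c ∈ B, g * c * g⁻¹ ∈ B := fun g c hc =>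
    Subgroup.Normal.conj_mem ‹_› c hc g
  have hind : ∀ x y : G, p x = p y → ∀ c ∈ B, x * c * x⁻¹ = y * c * y⁻¹ := by
    intro x y hxy c hc
    have h1 : y⁻¹ * x ∈ B := QuotientGroup.eq.1 hxy.symm
    have h2 := hB.comm _ h1 _ hc
    calc x * c * x⁻¹ = y * (y⁻¹ * x * c) * x⁻¹ := by group
      _ = y * c * y⁻¹ := by rw [h2]; group
  choose s hs using p.subgroupMap_surjective H
  have hs' : ∀ x : H, p (s (p.subgroupMap H x)) = p x := fun x => congrArg Subtype.val (hs _)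
  -- The conjugates of `b` under `H` are finitely many, since `B` acts trivially on itself. They
  -- generate an `H`-invariant lattice of rank at most two, on which `H` acts through a finite group
  -- of integral matrices.
  let S : Set G := Set.range fun q : H.map p => (s q : G) * b * (s q : G)⁻¹
  have hSmem : ∀ x : H, (x : G) * b * (x : G)⁻¹ ∈ S := fun x =>
    ⟨p.subgroupMap H x, hind _ _ (hs' x) b hb⟩
  set L := Subgroup.closure S with hL
  have hLB : L ≤ B := by
    rw [hL, Subgroup.closure_le]
    rintro _ ⟨q, rfl⟩
    exact hconj _ _ hb
  have hLconj : ∀ x : H, ∀ c ∈ L, (x : G) * c * (x : G)⁻¹ ∈ L := by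
    intro x c hc
    have : L ≤ L.comap (MulAut.conj (x : G)).toMonoidHom := by
      rw [hL, Subgroup.closure_le]
      rintro _ ⟨q, rfl⟩
      refine Subgroup.subset_closure ?_
      have := hSmem (x * s q)
      simpa [mul_assoc] using this
    simpa using this hc
  have hbL : b ∈ L := Subgroup.subset_closure (by simpa using hSmem 1)
  let _ : CommGroup L := { (inferInstance : Group L) with
    mul_comm := fun x y => Subtype.ext (hB.comm _ (hLB x.2) _ (hLB y.2)) }
  have : Group.FG L := (Group.fg_iff_subgroup_fg L).2
    ((Subgroup.fg_iff L).2 ⟨S, rfl, Set.finite_range _⟩)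
  obtain ⟨r, ⟨e⟩⟩ := CommGroup.exists_mulEquiv_pi L fun x j hj hx =>
    Subtype.ext (hB.eq_one x (hLB x.2) j hj (congrArg Subtype.val hx))
  have hr : r ≤ 2 := by
    by_contra! hr
    have h1 := ((NontorsionChain.multiplicative_pi r).mono hr).top_of_injective
      (f := e.symm.toMonoidHom) e.symm.injective
    exact h3 (h1.of_subgroup.weaken hLB)
  let ρ₀ : H →* Monoid.End L :=
    { toFun := fun x =>
        { toFun := fun c => ⟨(x : G) * c * (x : G)⁻¹, hLconj x c c.2⟩
          map_one' := by ext; simp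
          map_mul' := fun c d => by ext; simp }
      map_one' := by
        ext c
        change (1 : G) * c * (1 : G)⁻¹ = c
        simp
      map_mul' := fun x y => by
        ext c
        change ((x : G) * y) * c * ((x : G) * y)⁻¹ = x * (y * c * (y : G)⁻¹) * (x : G)⁻¹
        simp [mul_assoc] }
  let ρ₁ : H →* Module.End ℤ (Fin r → ℤ) :=
    { toFun := fun x => AddMonoidHom.toIntLinearMap (AddMonoidHom.mk'
        (fun v => Multiplicative.toAdd (e (ρ₀ x (e.symm (Multiplicative.ofAdd v)))))
        fun v w => by rw [ofAdd_add, map_mul, map_mul, map_mul, toAdd_mul])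
      map_one' := by
        refine LinearMap.ext fun v => ?_
        change Multiplicative.toAdd (e (ρ₀ 1 (e.symm (Multiplicative.ofAdd v)))) = v
        simp
      map_mul' := fun x y => by
        refine LinearMap.ext fun v => ?_
        change Multiplicative.toAdd (e (ρ₀ (x * y) (e.symm (Multiplicative.ofAdd v)))) =
          Multiplicative.toAdd (e (ρ₀ x (e.symm (Multiplicative.ofAdd (Multiplicative.toAdd
            (e (ρ₀ y (e.symm (Multiplicative.ofAdd v)))))))))
        simp }
  let ρ : H →* Matrix (Fin r) (Fin r) ℤ :=
    (LinearMap.toMatrixAlgEquiv' (R := ℤ) (n := Fin r) :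
      Module.End ℤ (Fin r → ℤ) →* Matrix (Fin r) (Fin r) ℤ).comp ρ₁
  have hρ₀ : ∀ x : H, ρ₀ (s (p.subgroupMap H x)) = ρ₀ x := fun x => by
    ext c
    exact hind _ _ (hs' x) c (hLB c.2)
  have hρ : (Set.range ρ).Finite := by
    refine (Set.finite_range fun q : H.map p => ρ (s q)).subset ?_
    rintro _ ⟨x, rfl⟩
    refine ⟨p.subgroupMap H x, ?_⟩
    have : ρ₁ (s (p.subgroupMap H x)) = ρ₁ x := by
      refine LinearMap.ext fun v => ?_
      change Multiplicative.toAdd (e (ρ₀ _ _)) = Multiplicative.toAdd (e (ρ₀ _ _))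
      rw [hρ₀]
    change LinearMap.toMatrixAlgEquiv' (ρ₁ _) = LinearMap.toMatrixAlgEquiv' (ρ₁ _)
    rw [this]
  have h1 : LinearMap.toMatrixAlgEquiv' (ρ₁ h) = 1 :=
    Matrix.eq_one_of_mem_derivedSeries_two hr ρ hρ hh
  have h2 : ρ₁ h = 1 := LinearMap.toMatrixAlgEquiv'.injective (by rw [h1, map_one])
  have h4 : Multiplicative.toAdd (e (ρ₀ h (e.symm (Multiplicative.ofAdd
      (Multiplicative.toAdd (e ⟨b, hbL⟩)))))) = Multiplicative.toAdd (e ⟨b, hbL⟩) :=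
    congrFun (congrArg DFunLike.coe h2) (Multiplicative.toAdd (e ⟨b, hbL⟩))
  have h5 : ρ₀ h ⟨b, hbL⟩ = ⟨b, hbL⟩ := by simpa using h4
  have h6 : (h : G) * b * (h : G)⁻¹ = b := congrArg Subtype.val h5
  exact mul_inv_eq_iff_eq_mul.1 h6

theorem derivedSeries_two_le_centralizer (hB : B.IsTorsionFreeAbelian) [B.Normal]
    (h3 : ¬ NontorsionChain B 3) (hlf : (⊤ : Subgroup (G ⧸ B)).IsLocallyFinite) :
    derivedSeries G 2 ≤ Subgroup.centralizer (B : Set G) := by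
  intro x hx
  obtain ⟨H, hH, h, hh, rfl⟩ := exists_fg_mem_derivedSeries hx
  rw [Subgroup.mem_centralizer_iff]
  intro b hb
  exact (hB.commute_of_mem_derivedSeries_two h3 (hlf _ le_top (hH.map_hom _)) hh hb).symm

end Subgroup.IsTorsionFreeAbelian

/-! ### Derived length modulo locally finite subgroups -/

section bounds

variable {G : Type u} [Group G]

/-- Schur's theorem applies: the part of `B` inside the `k`-th derived subgroup is central there,
and the quotient by it is locally finite. -/
theorem Subgroup.IsLocallyFinite.derivedSeries_succ_of_le_centralizer {B : Subgroup G} [B.Normal]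
    {k : ℕ} (hc : derivedSeries G k ≤ Subgroup.centralizer (B : Set G))
    (hlf : (derivedSeries (G ⧸ B) k).IsLocallyFinite) :
    (derivedSeries G (k + 1)).IsLocallyFinite := by
  rw [derivedSeries_succ]
  refine Subgroup.IsLocallyFinite.commutator_of_central (QuotientGroup.mk' B) ?_
    (hlf.mono (map_derivedSeries_le_derivedSeries _ _))
  intro x hx y hy
  rw [QuotientGroup.ker_mk'] at hx
  exact Subgroup.mem_centralizer_iff.1 (hc hy) x hx

theorem Subgroup.IsLocallyFinite.derivedSeries_of_ker {H : Type v} [Group H] (f : G →* H) {k : ℕ}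
    (hker : f.ker.IsLocallyFinite) (hlf : (derivedSeries H k).IsLocallyFinite) :
    (derivedSeries G k).IsLocallyFinite :=
  .of_map_of_ker f (hlf.mono (map_derivedSeries_le_derivedSeries f k)) (hker.mono inf_le_right)

/-- The common induction for the bounds on the derived length modulo locally finite subgroups. -/
theorem HasHirschLength.isLocallyFinite_derivedSeries_of {r k : ℕ}
    (key : ∀ (E : Type u) [Group E] (B : Subgroup E) [B.Normal], (∃ n, HasHirschLength E n) →
      B.IsTorsionFreeAbelian → B ≠ ⊥ → ¬ NontorsionChain (⊤ : Subgroup E) r →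
      (derivedSeries E k).IsLocallyFinite)
    (hk : 0 < k) {n : ℕ∞} (h : HasHirschLength G n) :
    ¬ NontorsionChain (⊤ : Subgroup G) r → (derivedSeries G k).IsLocallyFinite := by
  have hcomm : ∀ (G : Type u) [Group G], (∀ a b : G, a * b = b * a) →
      (derivedSeries G k).IsLocallyFinite := by
    intro G _ hG
    have : derivedSeries G k = ⊥ := by
      rw [eq_bot_iff]
      refine (derivedSeries_antitone G hk).trans ?_
      rw [derivedSeries_one, _root_.commutator_def, Subgroup.commutator_le]
      intro x _ y _
      rw [Subgroup.mem_bot, commutatorElement_eq_one_iff_mul_comm]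
      exact hG x y
    rw [this]
    intro H hH _
    rw [le_bot_iff.1 hH]
    infer_instance
  induction h with
  | of_finite G => exact fun _ => .of_finite _
  | of_int e =>
    refine fun _ => hcomm _ fun a b => ?_
    apply e.symm.injective
    rw [map_mul, map_mul, mul_comm]
  | of_mulEquiv e _ ih =>
    intro h
    refine .derivedSeries_of_ker e.symm.toMonoidHom ?_
      (ih fun h' => h (h'.top_of_injective (f := e.toMonoidHom) e.injective))
    rw [(MonoidHom.ker_eq_bot_iff _).2 e.symm.injective]
    intro H hH _
    rw [le_bot_iff.1 hH]
    infer_instance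
  | @of_extension G _ N _ a b hN hQ ihN ihQ =>
    intro h
    -- A locally finite `N` can be divided out. Otherwise the bound for `N` yields a nontrivial
    -- torsion-free abelian normal subgroup modulo a locally finite one, which is the situation of
    -- `key`.
    by_cases hlf : N.IsLocallyFinite
    · refine .derivedSeries_of_ker (QuotientGroup.mk' N) (by simpa using hlf)
        (ihQ fun h' => h (h'.top_of_surjective (QuotientGroup.mk'_surjective N)))
    · have h1 := (ihN fun h' => h (h'.top_of_injective N.subtype_injective)).map N.subtype
      obtain ⟨E, _, f, hf, hker, B, hBn, hB, hB1⟩ := exists_isTorsionFreeAbelian_quotient N hlf h1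
      refine .derivedSeries_of_ker f hker (key E B ?_ hB hB1 fun h' => h (h'.top_of_surjective hf))
      exact (HasHirschLength.of_extension N hN hQ).exists_of_surjective f hf
  | of_directed F hdir hsup n _ ih =>
    intro h
    refine Subgroup.IsLocallyFinite.mono ?_ (derivedSeries_le_iSup hdir hsup k)
    exact .of_directed (directed_derivedSeries_map hdir k) fun i =>
      (ih i fun h' => h (h'.top_of_injective (F i).subtype_injective)).map (F i).subtype

theorem Subgroup.IsLocallyFinite.quotient_top {B : Subgroup G} [B.Normal]
    (hG : ∃ n, HasHirschLength G n) {r : ℕ} (hB : NontorsionChain B r)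
    (h : ¬ NontorsionChain (⊤ : Subgroup G) (r + 1)) :
    (⊤ : Subgroup (G ⧸ B)).IsLocallyFinite := by
  obtain ⟨n, hn⟩ := hG
  obtain ⟨m, hm⟩ := hn.exists_of_surjective _ (QuotientGroup.mk'_surjective B)
  exact hm.isLocallyFinite_top fun h' => h (hB.top_add h')

/-- A nontrivial torsion-free abelian `B` uses up the whole Hirsch length, so the quotient by it is
locally finite, while the first derived subgroup centralizes `B`. -/
theorem HasHirschLength.isLocallyFinite_derivedSeries_two {n : ℕ∞} (h : HasHirschLength G n)
    (h2 : ¬ NontorsionChain (⊤ : Subgroup G) 2) : (derivedSeries G 2).IsLocallyFinite := by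
  refine h.isLocallyFinite_derivedSeries_of ?_ two_pos h2
  intro E _ B _ hE hB hB1 h2
  exact .derivedSeries_succ_of_le_centralizer
    (hB.commutator_le_centralizer fun h' => h2 (h'.weaken le_top))
    ((Subgroup.IsLocallyFinite.quotient_top hE (hB.chain_one hB1) h2).mono le_top)

/-- If `B` has rank two, the quotient is locally finite and acts through metabelian groups of 2 × 2
matrices. If `B` has rank one, the quotient has Hirsch length at most one and the previous bound
applies to it. -/
theorem HasHirschLength.isLocallyFinite_derivedSeries_three {n : ℕ∞} (h : HasHirschLength G n)
    (h3 : ¬ NontorsionChain (⊤ : Subgroup G) 3) : (derivedSeries G 3).IsLocallyFinite := by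
  refine h.isLocallyFinite_derivedSeries_of ?_ three_pos h3
  intro E _ B _ hE hB hB1 h3
  by_cases hB2 : NontorsionChain B 2
  · have hlf := Subgroup.IsLocallyFinite.quotient_top hE hB2 h3
    exact .derivedSeries_succ_of_le_centralizer
      (hB.derivedSeries_two_le_centralizer (fun h' => h3 (h'.weaken le_top)) hlf)
      (hlf.mono le_top)
  · obtain ⟨n, hn⟩ := hE
    obtain ⟨m, hm⟩ := hn.exists_of_surjective _ (QuotientGroup.mk'_surjective B)
    refine .derivedSeries_succ_of_le_centralizer
      ((derivedSeries_antitone E one_le_two).trans (hB.commutator_le_centralizer hB2)) ?_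
    refine hm.isLocallyFinite_derivedSeries_two fun h' => h3 ?_
    have := (hB.chain_one hB1).top_add h'
    exact this

end bounds

/-- The infimum of the empty set is `⊤`, so a finite value shows that the set is nonempty, and then
the infimum is attained. -/
theorem hasHirschLength_of_hirschLength_eq {G : Type u} [Group G] {n : ℕ∞} (hn : n ≠ ⊤)
    (h : hirschLength G = n) : HasHirschLength G n := by
  have hne : {n : ℕ∞ | HasHirschLength G n}.Nonempty := by
    by_contra hemp
    rw [Set.not_nonempty_iff_eq_empty] at hemp
    rw [hirschLength, hemp, sInf_empty] at h
    exact hn h.symm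
  have := csInf_mem hne
  rw [← h]
  exact this

/-! ### Torsion-free locally nilpotent groups of rank one -/

section TorsionFree

variable {G : Type v} [Group G]

/-- A nilpotent torsion-free group of rank one is abelian. -/
theorem Group.IsNilpotent.center_eq_top_of_not_chain [Group.IsNilpotent G]
    (htf : ∀ g : G, IsOfFinOrder g → g = 1) (h2 : ¬ NontorsionChain (⊤ : Subgroup G) 2) :
    Subgroup.center G = ⊤ := by
  by_contra hne
  have hQ : Nontrivial (G ⧸ Subgroup.center G) := by
    rw [QuotientGroup.nontrivial_iff]
    exact hne
  have hG : Nontrivial G := (QuotientGroup.mk'_surjective (Subgroup.center G)).nontrivial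
  obtain ⟨z, hz, hz1⟩ := (Subgroup.center G).bot_or_exists_ne_one.resolve_left
    (Group.IsNilpotent.center_ne_bot _)
  obtain ⟨x', hx', hx1⟩ :=
    (Subgroup.center (G ⧸ Subgroup.center G)).bot_or_exists_ne_one.resolve_left
      (Group.IsNilpotent.center_ne_bot _)
  obtain ⟨x, rfl⟩ := QuotientGroup.mk_surjective x'
  have hx1 : x ∉ Subgroup.center G := fun h => hx1 ((QuotientGroup.eq_one_iff x).2 h)
  -- With `x` in the second center, c = [y,x] is central and c^j = [y,x^j] = 1 once x^j is central,
  -- so torsion-freeness gives c = 1. Were no power of `x` central, `z` and `x` would give a chain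
  -- of length two.
  obtain ⟨j, hj, hxj⟩ : ∃ j : ℕ, 0 < j ∧ x ^ j ∈ Subgroup.center G := by
    by_contra! hcon
    refine h2 ((NontorsionChain.of_nontorsion hz fun j hj h => hz1 (htf z ?_)).step le_top ?_ x
      (Subgroup.mem_top x) hcon)
    · exact isOfFinOrder_iff_pow_eq_one.2 ⟨j, hj, h⟩
    · intro g _ k hk
      exact Subgroup.Normal.conj_mem inferInstance k hk g
  refine hx1 (Subgroup.mem_center_iff.2 fun y => ?_)
  have hc : y * x * y⁻¹ * x⁻¹ ∈ Subgroup.center G := by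
    rw [← QuotientGroup.eq_one_iff]
    have := Subgroup.mem_center_iff.1 hx' y
    simp only [QuotientGroup.mk_mul, QuotientGroup.mk_inv]
    rw [this]
    group
  set c := y * x * y⁻¹ * x⁻¹ with hcdef
  have h3 : y * x * y⁻¹ = c * x := by rw [hcdef]; group
  have h4 : c ^ j = 1 := by
    have h5 : (y * x * y⁻¹) ^ j = c ^ j * x ^ j := by
      rw [h3]
      exact Commute.mul_pow (Subgroup.mem_center_iff.1 hc x).symm j
    rw [conj_pow, Subgroup.mem_center_iff.1 hxj y, mul_inv_cancel_right] at h5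
    exact right_eq_mul.1 h5
  have h5 : c = 1 := htf c (isOfFinOrder_iff_pow_eq_one.2 ⟨j, hj, h4⟩)
  rw [h5, one_mul, mul_inv_eq_iff_eq_mul] at h3
  exact h3

theorem IsLocallyNilpotent.isTorsionFreeAbelian {N : Subgroup G}
    (htf : ∀ g : G, IsOfFinOrder g → g = 1) (hN : IsLocallyNilpotent N)
    (h2 : ¬ NontorsionChain N 2) : N.IsTorsionFreeAbelian := by
  refine ⟨fun x hx y hy => ?_, fun x _ j hj h => htf x (isOfFinOrder_iff_pow_eq_one.2 ⟨j, hj, h⟩)⟩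
  set H : Subgroup N := Subgroup.closure {⟨x, hx⟩, ⟨y, hy⟩}
  have : Group.IsNilpotent H := hN H ((Subgroup.fg_iff H).2 ⟨_, rfl, Set.toFinite _⟩)
  have hinj : Function.Injective (N.subtype.comp H.subtype) :=
    N.subtype_injective.comp H.subtype_injective
  have hcen := Group.IsNilpotent.center_eq_top_of_not_chain (G := H)
    (fun g hg => hinj (by
      rw [map_one]
      exact htf _ (MonoidHom.isOfFinOrder (N.subtype.comp H.subtype) hg)))
    (fun h => h2 ((h.top_of_injective H.subtype_injective).of_subgroup))
  have hxH : (⟨x, hx⟩ : N) ∈ H := Subgroup.subset_closure (by simp)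
  have hyH : (⟨y, hy⟩ : N) ∈ H := Subgroup.subset_closure (by simp)
  have := Subgroup.mem_center_iff.1 (hcen ▸ Subgroup.mem_top (⟨_, hyH⟩ : H)) ⟨_, hxH⟩
  exact congrArg (fun z : H => (z : G)) this

end TorsionFree

/-! ### The Hirsch–Plotkin radical and its centralizer -/

section Radical

variable {G : Type u} [Group G]

instance hirschPlotkinRadical_normal : (hirschPlotkinRadical G).Normal := by
  refine ⟨fun x hx g => ?_⟩
  have : hirschPlotkinRadical G ≤ (hirschPlotkinRadical G).comap (MulAut.conj g).toMonoidHom := by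
    refine sSup_le fun N hN y hy => ?_
    exact (le_sSup hN : N ≤ hirschPlotkinRadical G) (hN.1.conj_mem y hy g)
  exact this hx

theorem le_hirschPlotkinRadical {N : Subgroup G} [hN : N.Normal] (h : IsLocallyNilpotent N) :
    N ≤ hirschPlotkinRadical G :=
  le_sSup ⟨hN, h⟩

theorem not_chain_two_of_hirschLength_eq_one {K : Subgroup G} (h1 : hirschLength K = 1) :
    ¬ NontorsionChain K 2 := by
  intro h
  have := (hasHirschLength_of_hirschLength_eq (by simp) h1).le_of_chain h.to_subgroup
  exact absurd this (by decide)

theorem hirschPlotkinRadical_ne_bot (h1 : hirschLength (hirschPlotkinRadical G) = 1) :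
    hirschPlotkinRadical G ≠ ⊥ := by
  intro h
  have hfin : Finite (hirschPlotkinRadical G) := by rw [h]; infer_instance
  have : hirschLength (hirschPlotkinRadical G) ≤ 0 := sInf_le (HasHirschLength.of_finite _)
  rw [h1] at this
  exact absurd this (by decide)

/-- It suffices that any two members M, N of the defining family commute, so local nilpotence of the
join is not needed. A power of y ∈ M lies in N, which has rank one, so a power of x ∈ N is a power
of y; then x and its conjugate by y have a common power and coincide. -/
theorem hirschPlotkinRadical_isTorsionFreeAbelian (htf : ∀ g : G, IsOfFinOrder g → g = 1)
    (h2 : ¬ NontorsionChain (hirschPlotkinRadical G) 2) :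
    (hirschPlotkinRadical G).IsTorsionFreeAbelian := by
  have hle : ∀ N : Subgroup G, N.Normal ∧ IsLocallyNilpotent N → N ≤ hirschPlotkinRadical G :=
    fun N hN => le_sSup hN
  have hab : ∀ N : Subgroup G, N.Normal ∧ IsLocallyNilpotent N → N.IsTorsionFreeAbelian :=
    fun N hN => hN.2.isTorsionFreeAbelian htf fun h => h2 (h.weaken (hle N hN))
  have hcomm : ∀ M N : Subgroup G, M.Normal ∧ IsLocallyNilpotent M →
      N.Normal ∧ IsLocallyNilpotent N → M ≤ Subgroup.centralizer (N : Set G) := by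
    intro M N hM hN y hy
    rw [Subgroup.mem_centralizer_iff]
    intro x hx
    by_cases hx1 : x = 1
    · simp [hx1]
    by_cases hy1 : y = 1
    · simp [hy1]
    have hchain : NontorsionChain N 1 := (hab N hN).chain_one fun h => hx1 (by simpa [h] using hx)
    obtain ⟨k, hk, hyk⟩ : ∃ k : ℕ, 0 < k ∧ y ^ k ∈ N := by
      by_contra! hcon
      exact h2 (hchain.step (hle N hN) (fun g _ k hk => hN.1.conj_mem k hk g) y (hle M hM hy) hcon)
    have hyk1 : y ^ k ≠ 1 := fun h => hy1 ((hab M hM).eq_one y hy k hk h)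
    obtain ⟨i, hi, j, hij⟩ := (hab N hN).exists_pow_eq_zpow
      (fun h => h2 (h.weaken (hle N hN))) hyk hyk1 hx
    have h3 : y * x * y⁻¹ = x := by
      refine (hab N hN).eq_of_zpow (hN.1.conj_mem x hx y) hx (j := i) (by positivity) ?_
      rw [zpow_natCast, zpow_natCast, conj_pow, hij]
      group
    rw [mul_inv_eq_iff_eq_mul] at h3
    exact h3.symm
  have h3 : hirschPlotkinRadical G ≤ Subgroup.centralizer (hirschPlotkinRadical G : Set G) := by
    refine sSup_le fun M hM => ?_
    rw [Subgroup.le_centralizer_iff]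
    exact sSup_le fun N hN => hcomm N M hN hM
  exact ⟨fun x hx y hy => (Subgroup.mem_centralizer_iff.1 (h3 hx) y hy).symm,
    fun x _ j hj h => htf x (isOfFinOrder_iff_pow_eq_one.2 ⟨j, hj, h⟩)⟩

/-- A subgroup which is nilpotent of class at most two is locally nilpotent. -/
theorem IsLocallyNilpotent.of_commutator_le {A N : Subgroup G}
    (hc : N ≤ Subgroup.centralizer (A : Set G)) (h : ⁅N, N⁆ ≤ A) : IsLocallyNilpotent N := by
  have : Group.IsNilpotent N := by
    refine Subgroup.isNilpotent_of_ker_le_center (Abelianization.of (G := N)) ?_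
    rw [Abelianization.ker_of]
    intro x hx
    have hxA : (x : G) ∈ A := by
      apply h
      have := Subgroup.mem_map_of_mem N.subtype hx
      rw [_root_.commutator_def, Subgroup.map_commutator, ← MonoidHom.range_eq_map,
        Subgroup.range_subtype] at this
      exact this
    exact Subgroup.mem_center_iff.2 fun y =>
      Subtype.ext (Subgroup.mem_centralizer_iff.1 (hc y.2) x hxA).symm
  intro H _
  infer_instance

/-- In a torsion-free group of Hirsch length at most three whose Hirsch–Plotkin radical is abelian
and nontrivial, the radical is its own centralizer. -/
theorem centralizer_hirschPlotkinRadical_le (htf : ∀ g : G, IsOfFinOrder g → g = 1)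
    (hG : ∃ n, HasHirschLength G n) (h4 : ¬ NontorsionChain (⊤ : Subgroup G) 4)
    (hne : hirschPlotkinRadical G ≠ ⊥) (hA : (hirschPlotkinRadical G).IsTorsionFreeAbelian) :
    Subgroup.centralizer (hirschPlotkinRadical G : Set G) ≤ hirschPlotkinRadical G := by
  set A := hirschPlotkinRadical G with hAdef
  set C := Subgroup.centralizer (A : Set G) with hC
  obtain ⟨n, hn⟩ := hG
  obtain ⟨m, hm⟩ := hn.exists_of_surjective _ (QuotientGroup.mk'_surjective A)
  have hlf := hm.isLocallyFinite_derivedSeries_three fun h' => h4 ((hA.chain_one hne).top_add h')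
  have hbase : ⁅C ⊓ derivedSeries G 3, C ⊓ derivedSeries G 3⁆ = ⊥ := by
    have : (⁅C ⊓ derivedSeries G 3, C ⊓ derivedSeries G 3⁆ : Subgroup G).IsLocallyFinite := by
      refine .commutator_of_central (QuotientGroup.mk' A) ?_ (hlf.mono ?_)
      · intro x hx y hy
        rw [QuotientGroup.ker_mk'] at hx
        exact Subgroup.mem_centralizer_iff.1 hy.1 x hx
      · exact (Subgroup.map_mono inf_le_right).trans (map_derivedSeries_le_derivedSeries _ _)
    rw [eq_bot_iff]
    intro x hx
    exact htf x (this.isOfFinOrder hx)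
  have key : ∀ k, ⁅C ⊓ derivedSeries G k, C ⊓ derivedSeries G k⁆ ≤ A →
      C ⊓ derivedSeries G k ≤ A := fun k hk =>
    le_hirschPlotkinRadical (.of_commutator_le inf_le_left hk)
  -- The commutator subgroup of `C ⊓ derivedSeries G k` lies in `C ⊓ derivedSeries G (k + 1)`, hence
  -- in `A`, which `C` centralizes: the class is at most two.
  have step : ∀ k, C ⊓ derivedSeries G (k + 1) ≤ A → C ⊓ derivedSeries G k ≤ A := fun k hk =>
    key k (le_trans (le_inf (Subgroup.commutator_mono inf_le_left inf_le_left |>.trans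
      (Subgroup.commutator_le_left C C)) (by
        rw [derivedSeries_succ]
        exact Subgroup.commutator_mono inf_le_right inf_le_right)) hk)
  have h0 := step 0 (step 1 (step 2 (key 3 (hbase ▸ bot_le))))
  simpa using h0

end Radical

/-! ### Rational coordinates and the conjugation character -/

/-- Rational coordinates `φ` on a rank one torsion-free abelian normal subgroup `A`, together with
the character `χ` through which the group acts on `A` by conjugation. -/
structure RationalCoordinates {G : Type v} [Group G] (A : Subgroup G) (φ : G → ℚ) (χ : G →* ℚ) :
    Prop where
  map_mul : ∀ a ∈ A, ∀ b ∈ A, φ (a * b) = φ a + φ b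
  eq_one : ∀ a ∈ A, φ a = 0 → a = 1
  map_conj : ∀ g : G, ∀ a ∈ A, φ (g * a * g⁻¹) = χ g * φ a

namespace RationalCoordinates

variable {G : Type v} [Group G] {A : Subgroup G} {φ : G → ℚ} {χ : G →* ℚ}

theorem map_one (h : RationalCoordinates A φ χ) : φ 1 = 0 := by
  have := h.map_mul 1 A.one_mem 1 A.one_mem
  simpa using this

theorem map_inv (h : RationalCoordinates A φ χ) {a : G} (ha : a ∈ A) : φ a⁻¹ = -φ a := by
  have := h.map_mul a ha a⁻¹ (A.inv_mem ha)
  rw [mul_inv_cancel, h.map_one] at this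
  linarith

theorem map_pow (h : RationalCoordinates A φ χ) {a : G} (ha : a ∈ A) (k : ℕ) :
    φ (a ^ k) = k * φ a := by
  induction k with
  | zero => simp [h.map_one]
  | succ k ih =>
    rw [pow_succ, h.map_mul _ (A.pow_mem ha k) _ ha, ih]
    push_cast
    ring

theorem map_zpow (h : RationalCoordinates A φ χ) {a : G} (ha : a ∈ A) (k : ℤ) :
    φ (a ^ k) = k * φ a := by
  rcases Int.eq_nat_or_neg k with ⟨n, rfl | rfl⟩
  · simpa using h.map_pow ha n
  · rw [zpow_neg, h.map_inv (A.zpow_mem ha _), zpow_natCast, h.map_pow ha]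
    push_cast
    ring

theorem injOn (h : RationalCoordinates A φ χ) {a b : G} (ha : a ∈ A) (hb : b ∈ A)
    (hab : φ a = φ b) : a = b := by
  refine mul_inv_eq_one.1 (h.eq_one _ (A.mul_mem ha (A.inv_mem hb)) ?_)
  rw [h.map_mul _ ha _ (A.inv_mem hb), h.map_inv hb, hab]
  ring

theorem char_ne_zero (χ : G →* ℚ) (g : G) : χ g ≠ 0 := by
  intro h
  have : χ (g * g⁻¹) = 0 := by rw [_root_.map_mul, h, zero_mul]
  simp at this

theorem char_inv (χ : G →* ℚ) (g : G) : χ g⁻¹ = (χ g)⁻¹ := by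
  refine eq_inv_of_mul_eq_one_left ?_
  rw [← _root_.map_mul]
  simp

theorem char_zpow (χ : G →* ℚ) (g : G) (k : ℤ) : χ (g ^ k) = χ g ^ k := by
  rcases Int.eq_nat_or_neg k with ⟨n, rfl | rfl⟩
  · simp
  · simp [char_inv]

theorem char_eq_one_of_mem (h : RationalCoordinates A φ χ)
    (hcomm : ∀ x ∈ A, ∀ y ∈ A, x * y = y * x) (hne : A ≠ ⊥) {a : G} (ha : a ∈ A) : χ a = 1 := by
  obtain ⟨x, hx, hx1⟩ := A.bot_or_exists_ne_one.resolve_left hne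
  have := h.map_conj a x hx
  rw [hcomm a ha x hx, mul_inv_cancel_right] at this
  have hx0 : φ x ≠ 0 := fun h0 => hx1 (h.eq_one x hx h0)
  exact (mul_right_cancel₀ hx0 (by rw [one_mul]; exact this)).symm

theorem mem_of_char_eq_one (h : RationalCoordinates A φ χ) [A.Normal]
    (hc : Subgroup.centralizer (A : Set G) ≤ A) {g : G} (hg : χ g = 1) : g ∈ A := by
  refine hc (Subgroup.mem_centralizer_iff.2 fun a ha => ?_)
  have h1 := h.map_conj g a ha
  rw [hg, one_mul] at h1
  have h2 := h.injOn (Subgroup.Normal.conj_mem ‹_› a ha g) ha h1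
  exact (mul_inv_eq_iff_eq_mul.1 h2).symm

/-- The only rational roots of unity are ±1. If χ(g) = -1, then g² lies in `A` and is both fixed and
inverted by `g`, so g² = 1 and g = 1. -/
theorem mem_of_pow_mem (h : RationalCoordinates A φ χ) [A.Normal]
    (hc : Subgroup.centralizer (A : Set G) ≤ A)
    (hcomm : ∀ x ∈ A, ∀ y ∈ A, x * y = y * x) (hne : A ≠ ⊥)
    (htf : ∀ g : G, IsOfFinOrder g → g = 1) {g : G} {j : ℕ} (hj : 0 < j) (hg : g ^ j ∈ A) :
    g ∈ A := by
  have h1 := h.char_eq_one_of_mem hcomm hne hg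
  rw [_root_.map_pow] at h1
  have h2 : |χ g| = 1 := by
    refine (pow_eq_one_iff_of_nonneg (abs_nonneg _) hj.ne').1 ?_
    rw [← abs_pow, h1, abs_one]
  rcases abs_eq_abs.1 (h2.trans abs_one.symm) with h3 | h3
  · exact h.mem_of_char_eq_one hc h3
  · have h4 : g ^ 2 ∈ A := h.mem_of_char_eq_one hc (by rw [_root_.map_pow, h3]; norm_num)
    have h5 := h.map_conj g _ h4
    rw [h3, show g * g ^ 2 * g⁻¹ = g ^ 2 by group] at h5
    have h6 : g ^ 2 = 1 := h.eq_one _ h4 (by linarith)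
    rw [htf g (isOfFinOrder_iff_pow_eq_one.2 ⟨2, two_pos, h6⟩)]
    exact A.one_mem

end RationalCoordinates

/-- Fix a₀ ≠ 1 in `A` and put φ(a) = j/i whenever a^i = a₀^j; then χ(g) is the coordinate of the
conjugate of a₀ by g. Off `A` the values of φ are arbitrary. -/
theorem Subgroup.IsTorsionFreeAbelian.exists_rationalCoordinates {G : Type v} [Group G]
    {A : Subgroup G} [A.Normal] (hA : A.IsTorsionFreeAbelian) (h2 : ¬ NontorsionChain A 2)
    (hne : A ≠ ⊥) : ∃ (φ : G → ℚ) (χ : G →* ℚ), RationalCoordinates A φ χ := by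
  classical
  obtain ⟨a₀, ha₀, ha₀1⟩ := A.bot_or_exists_ne_one.resolve_left hne
  have hconj : ∀ g : G, ∀ c ∈ A, g * c * g⁻¹ ∈ A := fun g c hc =>
    Subgroup.Normal.conj_mem ‹_› c hc g
  have hex : ∀ a ∈ A, ∃ q : ℤ × ℤ, q.1 ≠ 0 ∧ a ^ q.1 = a₀ ^ q.2 := by
    intro a ha
    obtain ⟨i, hi, j, hij⟩ := hA.exists_pow_eq_zpow h2 ha₀ ha₀1 ha
    exact ⟨(i, j), by simpa using hi.ne', by simpa using hij⟩
  choose! q hq0 hq using hex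
  have hinj : ∀ {i j : ℤ}, a₀ ^ i = a₀ ^ j → i = j := by
    intro i j hij
    by_contra hne
    refine ha₀1 (hA.eq_one_of_zpow ha₀ (sub_ne_zero.2 hne) ?_)
    rw [zpow_sub, hij, mul_inv_cancel]
  set φ : G → ℚ := fun a => ((q a).2 : ℚ) / (q a).1 with hφ
  have key : ∀ a ∈ A, ∀ i j : ℤ, i ≠ 0 → a ^ i = a₀ ^ j → φ a = j / i := by
    intro a ha i j hi hij
    have h1 : (q a).2 * i = j * (q a).1 := by
      apply hinj
      rw [zpow_mul, ← hq a ha, ← zpow_mul, mul_comm, zpow_mul, hij, ← zpow_mul]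
    have h3 : ((q a).1 : ℚ) ≠ 0 := by exact_mod_cast hq0 a ha
    have h4 : (i : ℚ) ≠ 0 := by exact_mod_cast hi
    change ((q a).2 : ℚ) / (q a).1 = j / i
    rw [div_eq_div_iff h3 h4]
    exact_mod_cast h1
  have hself : φ a₀ = 1 := by
    rw [key a₀ ha₀ 1 1 one_ne_zero rfl]
    norm_num
  have hmc : ∀ g : G, ∀ a ∈ A, φ (g * a * g⁻¹) = φ (g * a₀ * g⁻¹) * φ a := by
    intro g a ha
    have hg := hconj g a₀ ha₀
    rw [key _ (hconj g a ha) ((q a).1 * (q (g * a₀ * g⁻¹)).1)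
      ((q (g * a₀ * g⁻¹)).2 * (q a).2) (mul_ne_zero (hq0 a ha) (hq0 _ hg))]
    · push_cast
      rw [hφ]
      field_simp
    · rw [zpow_mul, conj_zpow, hq a ha, ← conj_zpow, ← zpow_mul, mul_comm, zpow_mul, hq _ hg,
        zpow_mul]
  let χ : G →* ℚ :=
    { toFun := fun g => φ (g * a₀ * g⁻¹)
      map_one' := by simpa using hself
      map_mul' := fun g h => by
        rw [← hmc g _ (hconj h a₀ ha₀)]
        congr 1
        group }
  refine ⟨φ, χ, ?_, ?_, fun g a ha => hmc g a ha⟩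
  · intro a ha b hb
    have h3 : ((q a).1 : ℚ) ≠ 0 := by exact_mod_cast hq0 a ha
    have h4 : ((q b).1 : ℚ) ≠ 0 := by exact_mod_cast hq0 b hb
    rw [key _ (A.mul_mem ha hb) ((q a).1 * (q b).1) ((q a).2 * (q b).1 + (q b).2 * (q a).1)
      (mul_ne_zero (hq0 a ha) (hq0 b hb))]
    · push_cast
      rw [hφ]
      field_simp
    · rw [Commute.mul_zpow (hA.comm a ha b hb), zpow_mul, hq a ha, mul_comm (q a).1,
        zpow_mul b, hq b hb, ← zpow_mul, ← zpow_mul, ← zpow_add]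
  · intro a ha h0
    have h3 : ((q a).1 : ℚ) ≠ 0 := by exact_mod_cast hq0 a ha
    have h4 : (q a).2 = 0 := by
      have := (div_eq_zero_iff.1 h0).resolve_right h3
      exact_mod_cast this
    refine hA.eq_one_of_zpow ha (hq0 a ha) ?_
    rw [hq a ha, h4, zpow_zero]

/-- A finitely generated torsion-free abelian group of Hirsch length two is free abelian of
rank two. -/
theorem exists_basis_of_chain_two {Q : Type v} [Group Q] [Group.FG Q]
    (hcomm : ∀ a b : Q, a * b = b * a) (htf : ∀ x : Q, ∀ j : ℕ, 0 < j → x ^ j = 1 → x = 1)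
    (h2 : NontorsionChain (⊤ : Subgroup Q) 2) (h3 : ¬ NontorsionChain (⊤ : Subgroup Q) 3) :
    ∃ q₁ q₂ : Q, (∀ q, ∃ k l : ℤ, q = q₁ ^ k * q₂ ^ l) ∧
      ∀ k l : ℤ, q₁ ^ k * q₂ ^ l = 1 → k = 0 ∧ l = 0 := by
  let _ : CommGroup Q := { (inferInstance : Group Q) with mul_comm := hcomm }
  obtain ⟨r, ⟨e⟩⟩ := CommGroup.exists_mulEquiv_pi Q htf
  have hr2 := (h2.top_of_injective (f := e.toMonoidHom) e.injective).two_le_of_pi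
  have hr3 : r < 3 := by
    by_contra! hr
    exact h3 (((NontorsionChain.multiplicative_pi r).mono hr).top_of_injective
      (f := e.symm.toMonoidHom) e.symm.injective)
  obtain rfl : r = 2 := by omega
  have key : ∀ k l : ℤ, e (e.symm (Multiplicative.ofAdd ![1, 0]) ^ k *
      e.symm (Multiplicative.ofAdd ![0, 1]) ^ l) = Multiplicative.ofAdd ![k, l] := by
    intro k l
    rw [map_mul, map_zpow, map_zpow, e.apply_symm_apply, e.apply_symm_apply]
    apply Multiplicative.toAdd.injective
    rw [toAdd_mul, toAdd_zpow, toAdd_zpow]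
    ext i
    fin_cases i <;> simp
  refine ⟨e.symm (Multiplicative.ofAdd ![1, 0]), e.symm (Multiplicative.ofAdd ![0, 1]), ?_, ?_⟩
  · intro q
    refine ⟨Multiplicative.toAdd (e q) 0, Multiplicative.toAdd (e q) 1, e.injective ?_⟩
    rw [key]
    apply Multiplicative.toAdd.injective
    ext i
    fin_cases i <;> rfl
  · intro k l hkl
    have := key k l
    rw [hkl, map_one] at this
    have h0 := congrFun (congrArg Multiplicative.toAdd this) 0
    have h1 := congrFun (congrArg Multiplicative.toAdd this) 1
    exact ⟨h0.symm, h1.symm⟩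

/-! ### The metabelian Baumslag–Solitar group -/

namespace MetabelianBaumslagSolitar

variable {m n : ℤ}

/-- The image of the generator `a`. -/
def a (m n : ℤ) : MetabelianBaumslagSolitar m n :=
  QuotientGroup.mk (PresentedGroup.of 0)

/-- The image of the generator `t`. -/
def t (m n : ℤ) : MetabelianBaumslagSolitar m n :=
  QuotientGroup.mk (PresentedGroup.of 1)

theorem relation : t m n * a m n ^ m * (t m n)⁻¹ = a m n ^ n := by
  have h : (PresentedGroup.of 1 * PresentedGroup.of 0 ^ m * (PresentedGroup.of 1)⁻¹ *
      (PresentedGroup.of 0 ^ n)⁻¹ : BaumslagSolitar m n) = 1 :=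
    PresentedGroup.one_of_mem (rels := {FreeGroup.of (1 : Fin 2) * FreeGroup.of 0 ^ m *
      (FreeGroup.of 1)⁻¹ * (FreeGroup.of 0 ^ n)⁻¹}) rfl
  exact congrArg (QuotientGroup.mk (s := ⁅BaumslagSolitar.base m n, BaumslagSolitar.base m n⁆))
    (mul_inv_eq_one.1 h)

theorem closure_eq_top : Subgroup.closure {a m n, t m n} = ⊤ := by
  have h := PresentedGroup.closure_range_of ({FreeGroup.of 1 * FreeGroup.of 0 ^ m *
    (FreeGroup.of 1)⁻¹ * (FreeGroup.of 0 ^ n)⁻¹} : Set (FreeGroup (Fin 2)))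
  have h1 := congrArg (Subgroup.map (QuotientGroup.mk'
    ⁅BaumslagSolitar.base m n, BaumslagSolitar.base m n⁆)) h
  rw [MonoidHom.map_closure, Subgroup.map_top_of_surjective _ (QuotientGroup.mk'_surjective _)]
    at h1
  rw [← h1]
  congr 1
  ext x
  constructor
  · rintro (rfl | rfl)
    · exact ⟨_, ⟨0, rfl⟩, rfl⟩
    · exact ⟨_, ⟨1, rfl⟩, rfl⟩
  · rintro ⟨_, ⟨i, rfl⟩, rfl⟩
    fin_cases i
    · exact Or.inl rfl
    · exact Or.inr rfl

/-- The conjugates of `a` by powers of `t`. -/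
def conj (m n i : ℤ) : MetabelianBaumslagSolitar m n := t m n ^ i * a m n * (t m n ^ i)⁻¹

theorem conj_comm (i j : ℤ) : conj m n i * conj m n j = conj m n j * conj m n i := by
  have hmem : ∀ i : ℤ, (PresentedGroup.of 1 ^ i * PresentedGroup.of 0 *
      (PresentedGroup.of 1 ^ i)⁻¹ : BaumslagSolitar m n) ∈ BaumslagSolitar.base m n := fun i =>
    Subgroup.normalClosure_normal.conj_mem _ (Subgroup.subset_normalClosure (Set.mem_singleton _)) _
  set p := QuotientGroup.mk' ⁅BaumslagSolitar.base m n, BaumslagSolitar.base m n⁆ with hp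
  have he : ∀ i : ℤ, p (PresentedGroup.of 1 ^ i * PresentedGroup.of 0 *
      (PresentedGroup.of 1 ^ i)⁻¹) = conj m n i := fun i => by
    rw [map_mul, map_mul, map_inv, map_zpow]
    rfl
  have h := Subgroup.commutator_mem_commutator (hmem i) (hmem j)
  rw [← QuotientGroup.ker_mk' ⁅BaumslagSolitar.base m n, BaumslagSolitar.base m n⁆, ← hp,
    MonoidHom.mem_ker, map_commutatorElement, commutatorElement_eq_one_iff_mul_comm, he, he] at h
  exact h

theorem conj_zpow_eq (i k : ℤ) : conj m n i ^ k = t m n ^ i * a m n ^ k * (t m n ^ i)⁻¹ :=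
  conj_zpow

theorem conj_succ (i : ℤ) : conj m n (i + 1) ^ m = conj m n i ^ n := by
  rw [conj_zpow_eq, conj_zpow_eq, ← relation, zpow_add, zpow_one]
  group

/-- The subgroup generated by the conjugates of `a`, which is the image of the base. -/
def baseImage (m n : ℤ) : Subgroup (MetabelianBaumslagSolitar m n) :=
  Subgroup.closure (Set.range (conj m n))

instance baseImage_normal : (baseImage m n).Normal := by
  have key : ∀ e : ℤ, ∀ x ∈ baseImage m n, t m n ^ e * x * (t m n ^ e)⁻¹ ∈ baseImage m n := by
    intro e x hx
    have : baseImage m n ≤ (baseImage m n).comap (MulAut.conj (t m n ^ e)).toMonoidHom := by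
      rw [baseImage, Subgroup.closure_le]
      rintro _ ⟨i, rfl⟩
      refine Subgroup.subset_closure ⟨e + i, ?_⟩
      change conj m n (e + i) = t m n ^ e * conj m n i * (t m n ^ e)⁻¹
      rw [conj, conj, zpow_add]
      group
    exact this hx
  rw [← Subgroup.normalizer_eq_top_iff, eq_top_iff, ← closure_eq_top, Subgroup.closure_le]
  rintro x (rfl | rfl)
  · exact Subgroup.le_normalizer (Subgroup.subset_closure ⟨0, by simp [conj]⟩)
  · refine Subgroup.mem_normalizer_iff.2 fun x =>
      ⟨fun hx => by simpa using key 1 x hx, fun hx => ?_⟩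
    have := key (-1) _ hx
    simpa [mul_assoc] using this

theorem exists_eq_mul_zpow (y : MetabelianBaumslagSolitar m n) :
    ∃ b ∈ baseImage m n, ∃ k : ℤ, y = b * t m n ^ k := by
  have h : baseImage m n ⊔ Subgroup.zpowers (t m n) = ⊤ := by
    rw [eq_top_iff, ← closure_eq_top, Subgroup.closure_le]
    rintro x (rfl | rfl)
    · exact Subgroup.mem_sup_left (Subgroup.subset_closure ⟨0, by simp [conj]⟩)
    · exact Subgroup.mem_sup_right (Subgroup.mem_zpowers _)
  have hy : y ∈ baseImage m n ⊔ Subgroup.zpowers (t m n) := h ▸ Subgroup.mem_top y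
  obtain ⟨b, hb, _, ⟨k, rfl⟩, rfl⟩ := Subgroup.mem_sup_of_normal_left.1 hy
  exact ⟨b, hb, k, rfl⟩

theorem baseImage_comm {x y : MetabelianBaumslagSolitar m n} (hx : x ∈ baseImage m n)
    (hy : y ∈ baseImage m n) : x * y = y * x := by
  have h1 : baseImage m n ≤ Subgroup.centralizer (baseImage m n : Set _) := by
    rw [baseImage, Subgroup.centralizer_closure, Subgroup.closure_le]
    rintro _ ⟨i, rfl⟩
    refine Subgroup.mem_centralizer_iff.2 ?_
    rintro _ ⟨j, rfl⟩
    exact conj_comm j i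
  exact (Subgroup.mem_centralizer_iff.1 (h1 hx) y hy).symm

/-- Since `m` and `n` are coprime, finitely many consecutive conjugates of `a` generate a cyclic
subgroup. -/
theorem exists_conj_eq_zpow (hmn : IsCoprime m n) (s : ℤ) (L : ℕ) :
    ∃ c ∈ baseImage m n, ∀ i : ℕ, i ≤ L → conj m n (s + i) = c ^ (n ^ i * m ^ (L - i)) := by
  have hmem : ∀ i, conj m n i ∈ baseImage m n := fun i => Subgroup.subset_closure ⟨i, rfl⟩
  induction L with
  | zero => exact ⟨conj m n s, hmem s, fun i hi => by simp [Nat.le_zero.1 hi]⟩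
  | succ L ih =>
    obtain ⟨c, hc, hci⟩ := ih
    -- Here d^m = c^(n^(L+1)) with coprime exponents, so the Bézout combination c^p d^q has `c` as
    -- its m-th power and `d` as its n^(L+1)-th power.
    obtain ⟨p, q, hpq⟩ := hmn.pow_right (n := L + 1)
    set d := conj m n (s + (L + 1 : ℕ)) with hd
    have hdm : d ^ m = c ^ (n ^ (L + 1)) := by
      have h1 := conj_succ (m := m) (n := n) (s + L)
      rw [hci L le_rfl, Nat.sub_self, pow_zero, mul_one, ← zpow_mul, ← pow_succ] at h1
      rw [hd, ← h1]
      push_cast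
      rw [add_assoc]
    have hcomm : Commute c d := baseImage_comm hc (hmem _)
    have e1 : (c ^ p * d ^ q) ^ m = c := by
      rw [(hcomm.zpow_zpow p q).mul_zpow, ← zpow_mul, ← zpow_mul, mul_comm q m, zpow_mul d, hdm,
        ← zpow_mul, ← zpow_add, mul_comm (n ^ (L + 1)) q, hpq, zpow_one]
    have e2 : (c ^ p * d ^ q) ^ (n ^ (L + 1)) = d := by
      rw [(hcomm.zpow_zpow p q).mul_zpow, ← zpow_mul, ← zpow_mul, mul_comm p, zpow_mul c, ← hdm,
        ← zpow_mul, ← zpow_add, mul_comm m p, hpq, zpow_one]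
    refine ⟨c ^ p * d ^ q, mul_mem (zpow_mem hc _) (zpow_mem (hmem _) _), fun i hi => ?_⟩
    rcases Nat.lt_or_ge i (L + 1) with h | h
    · rw [hci i (by omega), show L + 1 - i = (L - i) + 1 by omega, pow_succ,
        mul_comm (m ^ (L - i)) m, mul_left_comm, zpow_mul (c ^ p * d ^ q), e1]
    · obtain rfl : i = L + 1 := by omega
      rw [Nat.sub_self, pow_zero, mul_one, e2]

/-- That a conjugate of `a` lies in the same cyclic group is what detects kernels: a homomorphism to
a torsion-free group killing a nontrivial `b` kills `c`, hence `a`. -/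
theorem exists_mem_zpowers (hmn : IsCoprime m n) {b : MetabelianBaumslagSolitar m n}
    (hb : b ∈ baseImage m n) : ∃ (c : MetabelianBaumslagSolitar m n) (k l i : ℤ),
      b = c ^ k ∧ conj m n i = c ^ l := by
  let F : ℕ → Subgroup (MetabelianBaumslagSolitar m n) := fun L =>
    Subgroup.closure (conj m n '' Set.Icc (-L : ℤ) L)
  have hF : Monotone F := fun L M hLM =>
    Subgroup.closure_mono (Set.image_mono
      (Set.Icc_subset_Icc (by simpa using hLM) (by simpa using hLM)))
  have hle : baseImage m n ≤ ⨆ L, F L := by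
    rw [baseImage, Subgroup.closure_le]
    rintro _ ⟨i, rfl⟩
    refine (le_iSup F i.natAbs) (Subgroup.subset_closure ⟨i, ?_, rfl⟩)
    constructor <;> omega
  obtain ⟨L, hL⟩ := (Subgroup.mem_iSup_of_directed hF.directed_le).1 (hle hb)
  obtain ⟨c, -, hc⟩ := exists_conj_eq_zpow hmn (-L) (2 * L)
  have : F L ≤ Subgroup.zpowers c := by
    rw [Subgroup.closure_le]
    rintro _ ⟨i, hi, rfl⟩
    obtain ⟨j, hj⟩ := Int.eq_ofNat_of_zero_le (show 0 ≤ i + L by linarith [hi.1])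
    have := hc j (by have := hi.2; omega)
    rw [show -(L : ℤ) + j = i by omega] at this
    exact ⟨_, this.symm⟩
  obtain ⟨k, hk⟩ := this hL
  exact ⟨c, k, _, _, hk.symm, hc 0 (Nat.zero_le _)⟩

section lift

variable {G : Type v} [Group G] {A : Subgroup G} [A.Normal]

/-- The homomorphism from the metabelian Baumslag–Solitar group determined by elements satisfying
the defining relation, the first of which lies in an abelian normal subgroup. -/
theorem exists_lift (hA : ∀ x ∈ A, ∀ y ∈ A, x * y = y * x) {x y : G} (hx : x ∈ A)
    (hxy : y * x ^ m * y⁻¹ = x ^ n) :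
    ∃ f : MetabelianBaumslagSolitar m n →* G, f (a m n) = x ∧ f (t m n) = y := by
  let g : BaumslagSolitar m n →* G := PresentedGroup.toGroup (f := ![x, y]) (by
    rintro _ rfl
    simp [hxy])
  have h0 : g (PresentedGroup.of 0) = x := by simp [g]
  have h1 : g (PresentedGroup.of 1) = y := by simp [g]
  have hbase : BaumslagSolitar.base m n ≤ A.comap g := by
    refine Subgroup.normalClosure_le_normal ?_
    rintro _ rfl
    simpa [h0] using hx
  have hker : ⁅BaumslagSolitar.base m n, BaumslagSolitar.base m n⁆ ≤ g.ker := by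
    rw [Subgroup.commutator_le]
    intro p hp q hq
    rw [MonoidHom.mem_ker, map_commutatorElement, commutatorElement_eq_one_iff_mul_comm]
    exact hA _ (hbase hp) _ (hbase hq)
  exact ⟨QuotientGroup.lift _ g hker, h0, h1⟩

theorem map_conj (f : MetabelianBaumslagSolitar m n →* G) (i : ℤ) :
    f (conj m n i) = f (t m n) ^ i * f (a m n) * (f (t m n) ^ i)⁻¹ := by
  simp [conj]

theorem map_mem_of_mem_baseImage (f : MetabelianBaumslagSolitar m n →* G) (ha : f (a m n) ∈ A)
    {b : MetabelianBaumslagSolitar m n} (hb : b ∈ baseImage m n) : f b ∈ A := by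
  have : baseImage m n ≤ A.comap f := by
    rw [baseImage, Subgroup.closure_le]
    rintro _ ⟨i, rfl⟩
    change f _ ∈ A
    rw [map_conj]
    exact Subgroup.Normal.conj_mem ‹_› _ ha _
  exact this hb

/-- The homomorphism is injective if the image of `a` has infinite order and no power of the image
of `t` lies in the abelian normal subgroup. -/
theorem injective_of_lift (hmn : IsCoprime m n) (f : MetabelianBaumslagSolitar m n →* G)
    (ha : f (a m n) ∈ A) (ha1 : f (a m n) ≠ 1) (htf : ∀ g : G, IsOfFinOrder g → g = 1)
    (ht : ∀ k : ℤ, f (t m n) ^ k ∈ A → k = 0) : Function.Injective f := by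
  have hbase {b} := map_mem_of_mem_baseImage (b := b) f ha
  rw [injective_iff_map_eq_one]
  intro y hy
  obtain ⟨b, hb, k, rfl⟩ := exists_eq_mul_zpow y
  have hk : k = 0 := by
    apply ht
    rw [map_mul, map_zpow] at hy
    rw [← inv_eq_of_mul_eq_one_right hy]
    exact A.inv_mem (hbase hb)
  subst hk
  rw [zpow_zero, mul_one] at hy ⊢
  obtain ⟨c, k, l, i, rfl, hc⟩ := exists_mem_zpowers hmn hb
  by_cases hk : k = 0
  · rw [hk, zpow_zero]
  · exfalso
    rw [map_zpow] at hy
    have hfc : f c = 1 := htf _ (isOfFinOrder_iff_zpow_eq_one.2 ⟨k, hk, hy⟩)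
    have h1 := map_conj f i
    rw [hc, map_zpow, hfc, one_zpow, eq_comm, mul_inv_eq_one, mul_eq_left] at h1
    exact ha1 h1

end lift

end MetabelianBaumslagSolitar

/-! ### Prime factors of rational numbers -/

section RationalNumbers

theorem padicValRat_ne_zero_of_dvd_den {p : ℕ} [hp : Fact p.Prime] {z : ℚ} (h : p ∣ z.den) :
    padicValRat p z ≠ 0 := by
  have h1 : 1 ≤ padicValNat p z.den := one_le_padicValNat_of_dvd z.den_ne_zero h
  have h2 : padicValInt p z.num = 0 := by
    refine padicValInt.eq_zero_of_not_dvd fun h' => ?_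
    exact Nat.Prime.not_coprime_iff_dvd.2
      ⟨p, hp.out, Int.natCast_dvd.1 h', h⟩ z.reduced
  rw [padicValRat_def, h2]
  intro h3
  simp only [Nat.cast_zero, zero_sub, neg_eq_zero, Nat.cast_eq_zero] at h3
  omega

theorem dvd_num_mul_den_of_padicValRat_ne_zero {p : ℕ} {z : ℚ} (h : padicValRat p z ≠ 0) :
    p ∣ (z.den * z.num).natAbs := by
  by_contra hcon
  rw [Int.natAbs_mul, Int.natAbs_natCast] at hcon
  apply h
  rw [padicValRat_def, padicValInt, padicValNat.eq_zero_of_not_dvd fun h' => hcon (h'.mul_left _),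
    padicValNat.eq_zero_of_not_dvd fun h' => hcon (h'.mul_right _)]
  simp

/-- No prime divides a denominator, so both `z` and its inverse are integers. -/
theorem Rat.sq_eq_one_of_padicValRat_eq_zero {z : ℚ} (hz : z ≠ 0)
    (h : ∀ p : ℕ, p.Prime → padicValRat p z = 0) : z ^ 2 = 1 := by
  have hden : ∀ z : ℚ, (∀ p : ℕ, p.Prime → padicValRat p z = 0) → z.den = 1 := by
    intro z h
    by_contra hne
    obtain ⟨p, hp, hpz⟩ := Nat.exists_prime_and_dvd hne
    have := Fact.mk hp
    exact padicValRat_ne_zero_of_dvd_den hpz (h p hp)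
  have h1 := hden z h
  have h2 := hden z⁻¹ fun p hp => by
    have := Fact.mk hp
    simp [padicValRat.inv, h p hp]
  have e1 : z = z.num := (Rat.coe_int_num_of_den_eq_one h1).symm
  have e2 : z⁻¹ = z⁻¹.num := (Rat.coe_int_num_of_den_eq_one h2).symm
  have h3 : z.num * z⁻¹.num = 1 := by
    have : z * z⁻¹ = 1 := mul_inv_cancel₀ hz
    rw [e2] at this
    nth_rw 1 [e1] at this
    exact_mod_cast this
  rcases Int.eq_one_or_neg_one_of_mul_eq_one h3 with h | h <;> rw [e1, h] <;> norm_num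

/-- Some power of `N` multiplies `z` into the integers. -/
def IsPowIntegral (N : ℤ) (z : ℚ) : Prop := ∃ (l : ℕ) (k : ℤ), (N : ℚ) ^ l * z = k

theorem IsPowIntegral.mul {N : ℤ} {y z : ℚ} (hy : IsPowIntegral N y) (hz : IsPowIntegral N z) :
    IsPowIntegral N (y * z) := by
  obtain ⟨l, k, h⟩ := hy
  obtain ⟨l', k', h'⟩ := hz
  refine ⟨l + l', k * k', ?_⟩
  push_cast
  rw [← h, ← h']
  ring

theorem IsPowIntegral.pow {N : ℤ} {z : ℚ} (hz : IsPowIntegral N z) (k : ℕ) :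
    IsPowIntegral N (z ^ k) := by
  induction k with
  | zero => exact ⟨0, 1, by simp⟩
  | succ k ih => rw [pow_succ]; exact ih.mul hz

theorem IsPowIntegral.zpow {N : ℤ} {z : ℚ} (hz : IsPowIntegral N z) (hz' : IsPowIntegral N z⁻¹)
    (k : ℤ) : IsPowIntegral N (z ^ k) := by
  rcases Int.eq_nat_or_neg k with ⟨n, rfl | rfl⟩
  · simpa using hz.pow n
  · simpa using hz'.pow n

theorem isPowIntegral_of_forall_prime {N : ℤ} (hN : N ≠ 0) {z : ℚ}
    (h : ∀ p : ℕ, p.Prime → padicValRat p z ≠ 0 → p ∣ N.natAbs) : IsPowIntegral N z := by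
  obtain ⟨l, hl⟩ : ∃ l, z.den ∣ N.natAbs ^ l := by
    refine (Nat.exists_dvd_pow_iff z.den_ne_zero (Int.natAbs_ne_zero.2 hN)).2 fun p hp => ?_
    have hp' := Nat.prime_of_mem_primeFactors hp
    have := Fact.mk hp'
    exact Nat.mem_primeFactors.2 ⟨hp', h p hp' (padicValRat_ne_zero_of_dvd_den
      (Nat.dvd_of_mem_primeFactors hp)), Int.natAbs_ne_zero.2 hN⟩
  obtain ⟨c, hc⟩ := (Int.natCast_dvd.2 (by rwa [Int.natAbs_pow]) : (z.den : ℤ) ∣ N ^ l)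
  refine ⟨l, c * z.num, ?_⟩
  have h1 : (N : ℚ) ^ l = z.den * c := by exact_mod_cast hc
  rw [h1]
  push_cast
  rw [mul_right_comm, Rat.den_mul_eq_num, mul_comm]

/-- Given two multiplicatively independent rational numbers `x` and `y`, there is a number
`n / m = x ^ i * y ^ (± 1)` in lowest terms such that all primes which occur in `x` or `y` divide
`m * n`. -/
theorem exists_coprime_of_independent {x y : ℚ} (hx : x ≠ 0) (hy : y ≠ 0)
    (hxy : ∀ k l : ℤ, x ^ k * y ^ l = 1 → k = 0 ∧ l = 0) :
    ∃ m n i ε : ℤ, 0 < m ∧ m ≤ |n| ∧ IsCoprime m n ∧ 2 ≤ (m * n).natAbs.primeFactors.card ∧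
      (ε * ε = 1) ∧ m * (x ^ i * y ^ ε) = n ∧
      IsPowIntegral (m * n) x ∧ IsPowIntegral (m * n) x⁻¹ ∧
      IsPowIntegral (m * n) y ∧ IsPowIntegral (m * n) y⁻¹ := by
  classical
  set T := (y.den * y.num).natAbs.primeFactors with hT
  have hynum : (y.den * y.num).natAbs ≠ 0 := by
    simp [hy]
  -- This exceeds every |v_p(y)|, so i·v_p(x) + v_p(y) vanishes only when both valuations do.
  set i : ℤ := 1 + ∑ p ∈ T, |padicValRat p y| with hi
  have hi1 : 1 ≤ i := by
    have := Finset.sum_nonneg (s := T) (f := fun p => |padicValRat p y|) fun p _ => abs_nonneg _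
    linarith
  have hilt : ∀ p : ℕ, p.Prime → |padicValRat p y| < i := by
    intro p hp
    by_cases h0 : padicValRat p y = 0
    · rw [h0, abs_zero]; linarith
    · have hpT : p ∈ T :=
        Nat.mem_primeFactors.2 ⟨hp, dvd_num_mul_den_of_padicValRat_ne_zero h0, hynum⟩
      have := Finset.single_le_sum (s := T) (f := fun p => |padicValRat p y|)
        (fun p _ => abs_nonneg _) hpT
      linarith
  have hv : ∀ p : ℕ, p.Prime → (padicValRat p x ≠ 0 ∨ padicValRat p y ≠ 0) →
      i * padicValRat p x + padicValRat p y ≠ 0 := by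
    intro p hp hor h0
    by_cases hpx : padicValRat p x = 0
    · rw [hpx, mul_zero, zero_add] at h0
      exact hor.elim (fun h => h hpx) (fun h => h h0)
    · have h1 : |i * padicValRat p x| = |padicValRat p y| := by
        rw [eq_neg_of_add_eq_zero_left h0, abs_neg]
      have h2 := hilt p hp
      rw [← h1, abs_mul, abs_of_pos (by linarith)] at h2
      have h3 : 1 ≤ |padicValRat p x| := Int.one_le_abs hpx
      nlinarith
  -- Inverting the number if necessary makes its absolute value at least one, which is `m ≤ |n|`.
  obtain ⟨ε, hε, hw1⟩ : ∃ ε : ℤ, ε * ε = 1 ∧ 1 ≤ |x ^ (ε * i) * y ^ ε| := by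
    rcases le_total 1 |x ^ i * y| with h | h
    · exact ⟨1, by norm_num, by simpa using h⟩
    · refine ⟨-1, by norm_num, ?_⟩
      have e : x ^ (-1 * i) * y ^ (-1 : ℤ) = (x ^ i * y)⁻¹ := by
        rw [neg_one_mul, zpow_neg, zpow_neg_one, mul_inv]
      rw [e, abs_inv]
      exact (one_le_inv₀ (abs_pos.2 (mul_ne_zero (zpow_ne_zero _ hx) hy))).2 h
  set w := x ^ (ε * i) * y ^ ε with hw
  have hw0 : w ≠ 0 := mul_ne_zero (zpow_ne_zero _ hx) (zpow_ne_zero _ hy)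
  have hε0 : ε ≠ 0 := by rintro rfl; simp at hε
  have hval : ∀ p : ℕ, p.Prime → padicValRat p w = ε * (i * padicValRat p x + padicValRat p y) := by
    intro p hp
    have := Fact.mk hp
    rw [hw, padicValRat.mul (zpow_ne_zero _ hx) (zpow_ne_zero _ hy), padicValRat.zpow,
      padicValRat.zpow]
    ring
  have hdvd : ∀ p : ℕ, p.Prime → (padicValRat p x ≠ 0 ∨ padicValRat p y ≠ 0) →
      p ∣ ((w.den : ℤ) * w.num).natAbs := by
    intro p hp h
    apply dvd_num_mul_den_of_padicValRat_ne_zero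
    rw [hval p hp]
    exact mul_ne_zero hε0 (hv p hp h)
  have hN : (w.den : ℤ) * w.num ≠ 0 := by simp [hw0]
  refine ⟨w.den, w.num, ε * i, ε, by exact_mod_cast w.den_pos, ?_, ?_, ?_, hε, ?_, ?_, ?_, ?_, ?_⟩
  · have h1 : |w| * w.den = |(w.num : ℚ)| := by
      rw [← Rat.mul_den_eq_num w, abs_mul w, Nat.abs_cast]
    have h2 : (w.den : ℚ) ≤ |(w.num : ℚ)| := by
      rw [← h1]
      exact le_mul_of_one_le_left (by positivity) hw1
    exact_mod_cast h2
  · exact (Rat.isCoprime_num_den w).symm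
  · by_contra! hcard
    obtain ⟨p, hp, hsub⟩ : ∃ p : ℕ, p.Prime ∧
        ((w.den : ℤ) * w.num).natAbs.primeFactors ⊆ {p} := by
      rcases Finset.eq_empty_or_nonempty ((w.den : ℤ) * w.num).natAbs.primeFactors with h | ⟨p, hp⟩
      -- With no prime at all, any prime serves as `p`.
      · exact ⟨2, Nat.prime_two, by simp [h]⟩
      · refine ⟨p, Nat.prime_of_mem_primeFactors hp, fun q hq => ?_⟩
        exact Finset.mem_singleton.2 (Finset.card_le_one.1 (by omega) q hq p hp)
    have := Fact.mk hp
    have hother : ∀ q : ℕ, q.Prime → q ≠ p → padicValRat q x = 0 ∧ padicValRat q y = 0 := by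
      intro q hq hqp
      by_contra hcon
      refine hqp (Finset.mem_singleton.1 (hsub (Nat.mem_primeFactors.2
        ⟨hq, hdvd q hq ?_, Int.natAbs_ne_zero.2 hN⟩)))
      tauto
    -- If `p` is the only prime, the valuations cancel in this product, so its square is 1.
    -- Independence then forces v_p(x) = 0, hence x² = 1, again contradicting independence.
    have hz : (x ^ padicValRat p y * y ^ (-padicValRat p x)) ^ 2 = 1 := by
      refine Rat.sq_eq_one_of_padicValRat_eq_zero
        (mul_ne_zero (zpow_ne_zero _ hx) (zpow_ne_zero _ hy)) fun q hq => ?_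
      have := Fact.mk hq
      rw [padicValRat.mul (zpow_ne_zero _ hx) (zpow_ne_zero _ hy), padicValRat.zpow,
        padicValRat.zpow]
      by_cases hqp : q = p
      · subst hqp; ring
      · rw [(hother q hq hqp).1, (hother q hq hqp).2]; ring
    have h1 := hxy (padicValRat p y * 2) (-padicValRat p x * 2) (by
      rw [zpow_mul, zpow_mul, ← mul_zpow]
      exact_mod_cast hz)
    have hx2 : x ^ 2 = 1 := by
      refine Rat.sq_eq_one_of_padicValRat_eq_zero hx fun q hq => ?_
      by_cases hqp : q = p
      · subst hqp
        have := h1.2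
        omega
      · exact (hother q hq hqp).1
    have := (hxy 2 0 (by rw [zpow_zero, mul_one]; exact_mod_cast hx2)).1
    omega
  · push_cast
    exact Rat.den_mul_eq_num w
  all_goals
    refine isPowIntegral_of_forall_prime hN fun p hp h => hdvd p hp ?_
    have := Fact.mk hp
    try rw [padicValRat.inv, neg_ne_zero] at h
    tauto

end RationalNumbers

/-! ### Local cyclicity in rank one -/

section LocallyCyclic

variable {G : Type v} [Group G] {A : Subgroup G}

/-- Uniqueness of roots reduces a relation between powers to b^i' = a^j' with coprime exponents; if
p·i' + q·j' = 1, then a^p b^q generates both. -/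
theorem Subgroup.IsTorsionFreeAbelian.exists_pair_mem_zpowers (hA : A.IsTorsionFreeAbelian)
    (h2 : ¬ NontorsionChain A 2) {a b : G} (ha : a ∈ A) (hb : b ∈ A) :
    ∃ c ∈ A, a ∈ Subgroup.zpowers c ∧ b ∈ Subgroup.zpowers c := by
  by_cases ha1 : a = 1
  · exact ⟨b, hb, ha1 ▸ one_mem _, Subgroup.mem_zpowers b⟩
  obtain ⟨i, hi, j, hij⟩ := hA.exists_pow_eq_zpow h2 ha ha1 hb
  have hg : 0 < Int.gcd i j := Int.gcd_pos_of_ne_zero_left _ (by exact_mod_cast hi.ne')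
  obtain ⟨i', j', hcop, hi', hj'⟩ := Int.exists_gcd_one hg
  have hroot : b ^ i' = a ^ j' := by
    refine hA.eq_of_zpow (A.zpow_mem hb _) (A.zpow_mem ha _) (j := (Int.gcd i j : ℤ))
      (by exact_mod_cast hg.ne') ?_
    rw [← zpow_mul, ← zpow_mul, ← hi', ← hj', zpow_natCast, hij]
  obtain ⟨p, q, hpq⟩ := Int.isCoprime_iff_gcd_eq_one.2 hcop
  have hc : Commute a b := hA.comm a ha b hb
  refine ⟨a ^ p * b ^ q, A.mul_mem (A.zpow_mem ha _) (A.zpow_mem hb _), ⟨i', ?_⟩, ⟨j', ?_⟩⟩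
  · change (a ^ p * b ^ q) ^ i' = a
    rw [(hc.zpow_zpow p q).mul_zpow, ← zpow_mul, ← zpow_mul, mul_comm q i', zpow_mul b, hroot,
      ← zpow_mul, ← zpow_add, mul_comm j' q, hpq, zpow_one]
  · change (a ^ p * b ^ q) ^ j' = b
    rw [(hc.zpow_zpow p q).mul_zpow, ← zpow_mul, ← zpow_mul, mul_comm p j', zpow_mul a, ← hroot,
      ← zpow_mul, ← zpow_add, mul_comm i' p, hpq, zpow_one]

/-- A rank one torsion-free abelian group is locally cyclic. -/
theorem Subgroup.IsTorsionFreeAbelian.exists_finset_subset_zpowers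
    (hA : A.IsTorsionFreeAbelian) (h2 : ¬ NontorsionChain A 2) (hne : A ≠ ⊥) {T : Set G}
    (hT : T.Finite) (hTA : T ⊆ A) : ∃ c ∈ A, c ≠ 1 ∧ T ⊆ Subgroup.zpowers c := by
  induction T, hT using Set.Finite.induction_on with
  | empty =>
    obtain ⟨c, hc, hc1⟩ := A.bot_or_exists_ne_one.resolve_left hne
    exact ⟨c, hc, hc1, Set.empty_subset _⟩
  | @insert a T _ _ ih =>
    rw [Set.insert_subset_iff] at hTA
    obtain ⟨c, hc, hc1, hTc⟩ := ih hTA.2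
    obtain ⟨d, hd, had, hcd⟩ := hA.exists_pair_mem_zpowers h2 hTA.1 hc
    refine ⟨d, hd, ?_, Set.insert_subset had fun x hx => Subgroup.zpowers_le.2 hcd (hTc hx)⟩
    rintro rfl
    rw [Subgroup.zpowers_one_eq_bot, Subgroup.mem_bot] at hcd
    exact hc1 hcd

end LocallyCyclic

theorem exists_eq_zpow_mul_zpow_of_closure {Q : Type v} [Group Q] {x y : Q} (h : Commute x y)
    {S : Set Q} (hS : Subgroup.closure S = ⊤)
    (hSxy : ∀ s ∈ S, ∃ k l : ℤ, s = x ^ k * y ^ l) (q : Q) : ∃ k l : ℤ, q = x ^ k * y ^ l := by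
  induction (hS ▸ Subgroup.mem_top q : q ∈ Subgroup.closure S) using
    Subgroup.closure_induction with
  | mem s hs => exact hSxy s hs
  | one => exact ⟨0, 0, by simp⟩
  | mul a b _ _ ha hb =>
    obtain ⟨k, l, rfl⟩ := ha
    obtain ⟨k', l', rfl⟩ := hb
    refine ⟨k + k', l + l', ?_⟩
    rw [zpow_add, zpow_add, mul_assoc, ← mul_assoc (y ^ l), ← (h.zpow_zpow k' l).eq]
    group
  | inv a _ ha =>
    obtain ⟨k, l, rfl⟩ := ha
    refine ⟨-k, -l, ?_⟩
    rw [mul_inv_rev, ← zpow_neg, ← zpow_neg, (h.zpow_zpow (-k) (-l)).eq]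

/-! ### Structure of the group over its radical -/

section Structure

variable {G : Type v} [Group G] {A : Subgroup G} {φ : G → ℚ} {χ : G →* ℚ}

/-- If `G` is finitely generated and `G ⧸ A` is free abelian of rank two, then the elements of `A`
are rational multiples of a single element, with denominators dividing powers of a number `N`
which is divisible by all primes in the image of the character. -/
theorem RationalCoordinates.exists_generator [Group.FG G] [A.Normal]
    (h : RationalCoordinates A φ χ) (hA : A.IsTorsionFreeAbelian) (h2 : ¬ NontorsionChain A 2)
    (hne : A ≠ ⊥) {x y : G} (hxy : ∀ g, ∃ k l : ℤ, (x ^ k * y ^ l)⁻¹ * g ∈ A)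
    (hxy1 : ∀ k l : ℤ, x ^ k * y ^ l ∈ A → k = 0 ∧ l = 0) (hcomm : x * y * x⁻¹ * y⁻¹ ∈ A)
    {N : ℤ} (hN : ∀ g, IsPowIntegral N (χ g)) :
    ∃ a ∈ A, a ≠ 1 ∧ ∀ b ∈ A, ∃ (l : ℕ) (k : ℤ), (N : ℚ) ^ l * φ b = k * φ a := by
  obtain ⟨S, hS, hSfin⟩ := Group.fg_iff.1 ‹Group.FG G›
  choose k l hkl using hxy
  -- Modulo these finitely many elements of `A`, the elements `x` and `y` commute and generate `G`.
  set T : Set G := insert (x * y * x⁻¹ * y⁻¹) ((fun s => (x ^ k s * y ^ l s)⁻¹ * s) '' S) with hT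
  have hTA : T ⊆ A := by
    refine Set.insert_subset hcomm ?_
    rintro _ ⟨s, _, rfl⟩
    exact hkl s
  obtain ⟨a, ha, ha1, hTa⟩ := hA.exists_finset_subset_zpowers h2 hne
    ((hSfin.image _).insert _) hTA
  let M : Subgroup G :=
    { carrier := {b | b ∈ A ∧ ∃ (l : ℕ) (k : ℤ), (N : ℚ) ^ l * φ b = k * φ a}
      one_mem' := ⟨A.one_mem, 0, 0, by simp [h.map_one]⟩
      mul_mem' := by
        rintro b c ⟨hb, l, k, hbe⟩ ⟨hc, l', k', hce⟩
        refine ⟨A.mul_mem hb hc, l + l', N ^ l' * k + N ^ l * k', ?_⟩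
        rw [h.map_mul _ hb _ hc]
        push_cast
        rw [add_mul, mul_assoc, mul_assoc, ← hbe, ← hce]
        ring
      inv_mem' := by
        rintro b ⟨hb, l, k, hbe⟩
        refine ⟨A.inv_mem hb, l, -k, ?_⟩
        rw [h.map_inv hb, mul_neg, hbe]
        push_cast
        ring }
  have hMA : M ≤ A := fun b hb => hb.1
  -- Conjugation by `g` multiplies coordinates by χ(g), whose denominator divides a power of `N`.
  have hMn : M.Normal := ⟨fun b hb g => by
    obtain ⟨hb, l, k, hbe⟩ := hb
    obtain ⟨l', k', hg⟩ := hN g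
    refine ⟨Subgroup.Normal.conj_mem ‹_› b hb g, l + l', k' * k, ?_⟩
    rw [h.map_conj g b hb]
    push_cast
    rw [mul_assoc, ← hbe, ← hg]
    ring⟩
  have haM : a ∈ M := ⟨ha, 0, 1, by simp⟩
  have hTM : T ⊆ M := hTa.trans (SetLike.coe_subset_coe.2 (Subgroup.zpowers_le.2 haM))
  refine ⟨a, ha, ha1, fun b hb => ?_⟩
  suffices hbM : b ∈ M from hbM.2
  set p := QuotientGroup.mk' M
  have hpker : ∀ g, p g = 1 ↔ g ∈ M := fun g => QuotientGroup.eq_one_iff g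
  have hpc : Commute (p x) (p y) := by
    have h1 : p (x * y * x⁻¹ * y⁻¹) = 1 := (hpker _).2 (hTM (Set.mem_insert _ _))
    simp only [_root_.map_mul, _root_.map_inv] at h1
    exact mul_inv_eq_iff_eq_mul.1 (mul_inv_eq_one.1 h1)
  have hpS : Subgroup.closure (p '' S) = ⊤ := by
    rw [← MonoidHom.map_closure, hS, Subgroup.map_top_of_surjective _
      (QuotientGroup.mk'_surjective M)]
  -- Modulo `M`, `b` is a product x^i y^j, which therefore lies in `A`; so both exponents vanish and
  -- `b` lies in `M`.
  obtain ⟨i, j, hij⟩ := exists_eq_zpow_mul_zpow_of_closure hpc hpS (by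
    rintro _ ⟨s, hs, rfl⟩
    refine ⟨k s, l s, ?_⟩
    have h1 : p ((x ^ k s * y ^ l s)⁻¹ * s) = 1 :=
      (hpker _).2 (hTM (Set.mem_insert_of_mem _ ⟨s, hs, rfl⟩))
    rw [_root_.map_mul, _root_.map_inv, inv_mul_eq_one] at h1
    rw [← h1, _root_.map_mul, _root_.map_zpow, _root_.map_zpow]) (p b)
  have h1 : (x ^ i * y ^ j)⁻¹ * b ∈ M := by
    rw [← hpker, _root_.map_mul, _root_.map_inv, hij, _root_.map_mul, _root_.map_zpow,
      _root_.map_zpow, inv_mul_cancel]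
  have h3 : x ^ i * y ^ j ∈ A := by
    have := A.mul_mem hb (A.inv_mem (hMA h1))
    simpa using this
  obtain ⟨rfl, rfl⟩ := hxy1 i j h3
  simpa using h1

/-- A subgroup invariant under an element acting as multiplication by `n / m` contains all `m`-th
and `n`-th roots of its elements. -/
theorem RationalCoordinates.exists_root [A.Normal] (h : RationalCoordinates A φ χ) {m n : ℤ}
    (hm : m ≠ 0) (hn : n ≠ 0) (hmn : IsCoprime m n) {H : Subgroup G} {g : G} (hg : g ∈ H)
    (hgχ : (m : ℚ) * χ g = n) {b : G} (hb : b ∈ A) (hbH : b ∈ H) :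
    ∃ c ∈ A, c ∈ H ∧ ((m * n : ℤ) : ℚ) * φ c = φ b := by
  have hm' : (m : ℚ) ≠ 0 := by exact_mod_cast hm
  have hn' : (n : ℚ) ≠ 0 := by exact_mod_cast hn
  have hconj : ∀ g : G, ∀ c ∈ A, g * c * g⁻¹ ∈ A := fun g c hc =>
    Subgroup.Normal.conj_mem ‹_› c hc g
  obtain ⟨u, v, huv⟩ := hmn
  have huv' : (u : ℚ) * m + v * n = 1 := by exact_mod_cast huv
  -- If u·m + v·n = 1, then b^u (g b g⁻¹)^v has coordinate (u + v·n/m)·φ(b) = φ(b)/m. Using g⁻¹ in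
  -- place of g gives division by n.
  have step1 : ∀ b ∈ A, b ∈ H → ∃ c ∈ A, c ∈ H ∧ (m : ℚ) * φ c = φ b := by
    intro b hb hbH
    refine ⟨b ^ u * (g * b * g⁻¹) ^ v, A.mul_mem (A.zpow_mem hb _) (A.zpow_mem (hconj g b hb) _),
      H.mul_mem (H.zpow_mem hbH _) (H.zpow_mem (H.mul_mem (H.mul_mem hg hbH) (H.inv_mem hg)) _), ?_⟩
    rw [h.map_mul _ (A.zpow_mem hb _) _ (A.zpow_mem (hconj g b hb) _), h.map_zpow hb,
      h.map_zpow (hconj g b hb), h.map_conj g b hb]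
    linear_combination φ b * huv' + v * φ b * hgχ
  have step2 : ∀ b ∈ A, b ∈ H → ∃ c ∈ A, c ∈ H ∧ (n : ℚ) * φ c = φ b := by
    intro b hb hbH
    have hgχ' : (n : ℚ) * χ g⁻¹ = m := by
      rw [RationalCoordinates.char_inv, ← hgχ, mul_assoc,
        mul_inv_cancel₀ (RationalCoordinates.char_ne_zero χ g), mul_one]
    have hgi := H.inv_mem hg
    refine ⟨b ^ v * (g⁻¹ * b * g⁻¹⁻¹) ^ u,
      A.mul_mem (A.zpow_mem hb _) (A.zpow_mem (hconj g⁻¹ b hb) _),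
      H.mul_mem (H.zpow_mem hbH _) (H.zpow_mem (H.mul_mem (H.mul_mem hgi hbH) (H.inv_mem hgi)) _),
      ?_⟩
    rw [h.map_mul _ (A.zpow_mem hb _) _ (A.zpow_mem (hconj g⁻¹ b hb) _), h.map_zpow hb,
      h.map_zpow (hconj g⁻¹ b hb), h.map_conj g⁻¹ b hb]
    linear_combination φ b * huv' + u * φ b * hgχ'
  obtain ⟨c, hc, hcH, hcb⟩ := step1 b hb hbH
  obtain ⟨d, hd, hdH, hdc⟩ := step2 c hc hcH
  refine ⟨d, hd, hdH, ?_⟩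
  push_cast
  rw [mul_assoc, hdc, hcb]

theorem RationalCoordinates.le_of_generator [A.Normal] (h : RationalCoordinates A φ χ) {m n : ℤ}
    (hm : m ≠ 0) (hn : n ≠ 0) (hmn : IsCoprime m n) {H : Subgroup G} {g a : G} (hg : g ∈ H)
    (hgχ : (m : ℚ) * χ g = n) (ha : a ∈ A) (haH : a ∈ H)
    (hgen : ∀ b ∈ A, ∃ (l : ℕ) (k : ℤ), ((m * n : ℤ) : ℚ) ^ l * φ b = k * φ a) : A ≤ H := by
  have hN : ((m * n : ℤ) : ℚ) ≠ 0 := by exact_mod_cast mul_ne_zero hm hn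
  have key : ∀ (l : ℕ) (k : ℤ), ∃ c ∈ A, c ∈ H ∧ ((m * n : ℤ) : ℚ) ^ l * φ c = k * φ a := by
    intro l k
    induction l with
    | zero => exact ⟨a ^ k, A.zpow_mem ha k, H.zpow_mem haH k, by
        rw [h.map_zpow ha, pow_zero, one_mul]⟩
    | succ l ih =>
      obtain ⟨c, hc, hcH, hce⟩ := ih
      obtain ⟨d, hd, hdH, hde⟩ := h.exists_root hm hn hmn hg hgχ hc hcH
      exact ⟨d, hd, hdH, by rw [pow_succ, mul_assoc, hde, hce]⟩
  intro b hb
  obtain ⟨l, k, hbe⟩ := hgen b hb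
  obtain ⟨c, hc, hcH, hce⟩ := key l k
  rwa [h.injOn hb hc (mul_left_cancel₀ (pow_ne_zero l hN) (hbe.trans hce.symm))]

end Structure

/-- A group with complementary subgroups `f(K) ≅ K`, which is normal, and `⟨x⟩`, where `x` has
infinite order, is a semidirect product of `K` with the integers. -/
theorem exists_semidirectProduct_int {G : Type v} [Group G] {K : Type w} [Group K] (f : K →* G)
    (hf : Function.Injective f) [f.range.Normal] {x : G} (hx : ¬ IsOfFinOrder x)
    (hcompl : f.range.IsComplement' (Subgroup.zpowers x)) :
    ∃ θ : Multiplicative ℤ →* MulAut K, Nonempty (G ≃* K ⋊[θ] Multiplicative ℤ) := by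
  have hinf : Function.Injective (zpowersHom G x) := by
    intro i j hij
    exact Multiplicative.toAdd.injective (injective_zpow_iff_not_isOfFinOrder.2 hx hij)
  have hrange : (zpowersHom G x).range = Subgroup.zpowers x := by
    ext y
    rfl
  let e₁ : f.range ≃* K := (MonoidHom.ofInjective hf).symm
  let e₂ : Subgroup.zpowers x ≃* Multiplicative ℤ :=
    (MulEquiv.subgroupCongr hrange.symm).trans (MonoidHom.ofInjective hinf).symm
  exact ⟨_, ⟨(SemidirectProduct.mulEquivSubgroup hcompl).symm.trans
    (SemidirectProduct.congr' e₁ e₂)⟩⟩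

/-- The structure of torsion-free groups which are extensions of a self-centralizing rank one
abelian normal subgroup by a free abelian group of rank two. -/
theorem exists_metabelianBaumslagSolitar_semidirectProduct {G : Type v} [Group G] [Group.FG G]
    (htf : ∀ g : G, IsOfFinOrder g → g = 1) {A : Subgroup G} [A.Normal]
    (hA : A.IsTorsionFreeAbelian) (h2 : ¬ NontorsionChain A 2) (hne : A ≠ ⊥)
    (hcent : Subgroup.centralizer (A : Set G) ≤ A)
    (h3 : NontorsionChain (⊤ : Subgroup G) 3) (h4 : ¬ NontorsionChain (⊤ : Subgroup G) 4) :
    ∃ m n : ℤ, 0 < m ∧ m ≤ |n| ∧ IsCoprime m n ∧ 2 ≤ (m * n).natAbs.primeFactors.card ∧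
      ∃ θ : Multiplicative ℤ →* MulAut (MetabelianBaumslagSolitar m n),
        Nonempty (G ≃* MetabelianBaumslagSolitar m n ⋊[θ] Multiplicative ℤ) := by
  obtain ⟨φ, χ, h⟩ := hA.exists_rationalCoordinates h2 hne
  have hcomm : _root_.commutator G ≤ A := by
    rw [← derivedSeries_one]
    exact (hA.commutator_le_centralizer h2).trans hcent
  set p := QuotientGroup.mk' A
  have hpker : ∀ g, p g = 1 ↔ g ∈ A := fun g => QuotientGroup.eq_one_iff g
  obtain ⟨q₁, q₂, hq, hq1⟩ := exists_basis_of_chain_two (Q := G ⧸ A)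
    (fun a b => by
      obtain ⟨a, rfl⟩ := QuotientGroup.mk'_surjective A a
      obtain ⟨b, rfl⟩ := QuotientGroup.mk'_surjective A b
      rw [← commutatorElement_eq_one_iff_mul_comm, ← map_commutatorElement, hpker]
      exact hcomm (Subgroup.commutator_mem_commutator (Subgroup.mem_top a) (Subgroup.mem_top b)))
    (fun a j hj ha => by
      obtain ⟨a, rfl⟩ := QuotientGroup.mk'_surjective A a
      rw [← map_pow, hpker] at ha
      exact (hpker a).2 (h.mem_of_pow_mem hcent hA.comm hne htf hj ha))
    (by
      -- At most one of the three steps is spent in `A`, so at least two remain in the quotient.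
      obtain ⟨a, b, hab, ha, hb⟩ := h3.split_top A
      refine hb.mono ?_
      by_contra! hlt
      exact h2 (ha.of_subgroup.mono (by omega)))
    (fun h' => h4 ((hA.chain_one hne).top_add h'))
  obtain ⟨x, rfl⟩ := QuotientGroup.mk'_surjective A q₁
  obtain ⟨y, rfl⟩ := QuotientGroup.mk'_surjective A q₂
  have hgen : ∀ g, ∃ k l : ℤ, (x ^ k * y ^ l)⁻¹ * g ∈ A := by
    intro g
    obtain ⟨k, l, hkl⟩ := hq (p g)
    refine ⟨k, l, ?_⟩
    rw [← hpker, map_mul, map_inv, hkl, map_mul, map_zpow, map_zpow, inv_mul_cancel]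
  have hindA : ∀ k l : ℤ, x ^ k * y ^ l ∈ A → k = 0 ∧ l = 0 := by
    intro k l hkl
    refine hq1 k l ?_
    rw [← map_zpow, ← map_zpow, ← map_mul]
    exact (hpker _).2 hkl
  have hind : ∀ k l : ℤ, χ x ^ k * χ y ^ l = 1 → k = 0 ∧ l = 0 := by
    intro k l hkl
    refine hindA k l (h.mem_of_char_eq_one hcent ?_)
    rw [map_mul, RationalCoordinates.char_zpow, RationalCoordinates.char_zpow, hkl]
  obtain ⟨m, n, i, ε, hm, hmn, hcop, hcard, hε, hw, hx1, hx2, hy1, hy2⟩ :=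
    exists_coprime_of_independent (RationalCoordinates.char_ne_zero χ x)
      (RationalCoordinates.char_ne_zero χ y) hind
  have hn : n ≠ 0 := by
    rintro rfl
    rw [abs_zero] at hmn
    omega
  have hχA : ∀ {a}, a ∈ A → χ a = 1 := fun ha => h.char_eq_one_of_mem hA.comm hne ha
  have hχ : ∀ g, ∃ k l : ℤ, χ g = χ x ^ k * χ y ^ l := by
    intro g
    obtain ⟨k, l, hkl⟩ := hgen g
    refine ⟨k, l, ?_⟩
    have h1 := hχA hkl
    rw [map_mul, RationalCoordinates.char_inv,
      inv_mul_eq_one₀ (RationalCoordinates.char_ne_zero χ _)] at h1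
    rw [← h1, map_mul, RationalCoordinates.char_zpow, RationalCoordinates.char_zpow]
  obtain ⟨a, ha, ha1, hagen⟩ := h.exists_generator hA h2 hne hgen hindA
    (hcomm (Subgroup.commutator_mem_commutator (Subgroup.mem_top x) (Subgroup.mem_top y)))
    (N := m * n) (fun g => by
      obtain ⟨k, l, hkl⟩ := hχ g
      rw [hkl]
      exact (hx1.zpow hx2 k).mul (hy1.zpow hy2 l))
  set g := x ^ i * y ^ ε with hg
  have hgχ : χ g = χ x ^ i * χ y ^ ε := by
    rw [hg, map_mul, RationalCoordinates.char_zpow, RationalCoordinates.char_zpow]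
  have hgmn : (m : ℚ) * χ g = n := by rw [hgχ, hw]
  have hε0 : ε ≠ 0 := by rintro rfl; simp at hε
  have hgpow : ∀ v : ℤ, χ (g ^ v) = χ x ^ (i * v) * χ y ^ (ε * v) := by
    intro v
    rw [RationalCoordinates.char_zpow, hgχ, mul_zpow, ← zpow_mul, ← zpow_mul]
  obtain ⟨f, hfa, hft⟩ := MetabelianBaumslagSolitar.exists_lift (m := m) (n := n) hA.comm
    (x := a) (y := g) ha (by
      refine h.injOn (Subgroup.Normal.conj_mem ‹_› _ (A.zpow_mem ha m) g) (A.zpow_mem ha n) ?_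
      rw [h.map_conj g _ (A.zpow_mem ha m), h.map_zpow ha, h.map_zpow ha]
      linear_combination φ a * hgmn)
  have hinj : Function.Injective f := by
    refine MetabelianBaumslagSolitar.injective_of_lift hcop f (A := A) (hfa ▸ ha) (hfa ▸ ha1) htf ?_
    intro v hv
    rw [hft] at hv
    have h1 := hχA hv
    rw [hgpow] at h1
    exact (mul_eq_zero.1 (hind _ _ h1).2).resolve_left hε0
  have hgf : g ∈ f.range := ⟨_, hft⟩
  have hAf : A ≤ f.range :=
    h.le_of_generator hm.ne' hn hcop hgf hgmn ha ⟨_, hfa⟩ hagen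
  -- The range contains `A`, hence the commutator subgroup of `G`.
  have hnormal : f.range.Normal := Subgroup.Normal.of_commutator_le _ (hcomm.trans hAf)
  have hxinf : ¬ IsOfFinOrder x := by
    intro hx
    obtain rfl := htf x hx
    exact absurd (hindA 1 0 (by simp)).1 one_ne_zero
  refine ⟨m, n, hm, hmn, hcop, hcard, exists_semidirectProduct_int f hinj hxinf ?_⟩
  refine Subgroup.isComplement'_of_disjoint_and_mul_eq_univ ?_ ?_
  · rw [Subgroup.disjoint_def]
    rintro _ ⟨z, rfl⟩ ⟨s, hs⟩
    obtain ⟨b, hb, v, rfl⟩ := MetabelianBaumslagSolitar.exists_eq_mul_zpow z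
    have hbA : f b ∈ A := MetabelianBaumslagSolitar.map_mem_of_mem_baseImage f (hfa ▸ ha) hb
    have h1 := congrArg χ hs
    change χ (x ^ s) = _ at h1
    rw [map_mul f, map_mul χ, hχA hbA, one_mul, map_zpow f, hft, hgpow,
      RationalCoordinates.char_zpow] at h1
    -- An element of the range acts as a power of χ(g), whose exponent of χ(y) is ε·v; equality with
    -- a power of χ(x) forces v = 0 by independence.
    have h5 : χ x ^ (i * v - s) * χ y ^ (ε * v) = 1 := by
      rw [zpow_sub₀ (RationalCoordinates.char_ne_zero χ x), h1, div_mul_eq_mul_div, div_self]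
      exact mul_ne_zero (zpow_ne_zero _ (RationalCoordinates.char_ne_zero χ x))
        (zpow_ne_zero _ (RationalCoordinates.char_ne_zero χ y))
    obtain ⟨h6, h7⟩ := hind _ _ h5
    have hv : v = 0 := (mul_eq_zero.1 h7).resolve_left hε0
    have hs0 : s = 0 := by
      rw [hv, mul_zero] at h6
      omega
    rw [← hs, hs0]
    exact zpow_zero x
  · rw [Set.eq_univ_iff_forall]
    intro z
    obtain ⟨k, l, hz⟩ := hχ z
    -- As ε² = 1, the character of g^(ε·l) is χ(x)^(i·ε·l) χ(y)^l, so g^(ε·l) x^s has the same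
    -- character as `z` and differs from it by an element of `A`.
    set s := k - i * (ε * l) with hs
    refine Set.mem_mul.2 ⟨z * (x ^ s)⁻¹, ?_, x ^ s, ⟨s, rfl⟩, by group⟩
    have h1 : (g ^ (ε * l))⁻¹ * (z * (x ^ s)⁻¹) ∈ A := by
      refine h.mem_of_char_eq_one hcent ?_
      rw [map_mul, map_mul, RationalCoordinates.char_inv, RationalCoordinates.char_inv, hgpow, hz,
        RationalCoordinates.char_zpow, ← mul_assoc ε, hε, one_mul, hs,
        zpow_sub₀ (RationalCoordinates.char_ne_zero χ x)]
      have := zpow_ne_zero k (RationalCoordinates.char_ne_zero χ x)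
      have := zpow_ne_zero l (RationalCoordinates.char_ne_zero χ y)
      have := zpow_ne_zero (i * (ε * l)) (RationalCoordinates.char_ne_zero χ x)
      field_simp
    have h5 := f.range.mul_mem (f.range.zpow_mem hgf (ε * l)) (hAf h1)
    rwa [mul_inv_cancel_left] at h5

theorem mainTheorem8 {G : Type u} [Group G] [Group.FG G]
    (htf : ∀ g : G, IsOfFinOrder g → g = 1)
    (hea : IsElementaryAmenable G)
    (h3 : hirschLength G = 3)
    (h1 : hirschLength (hirschPlotkinRadical G) = 1) :
    ∃ m n : ℤ, 0 < m ∧ m ≤ |n| ∧ IsCoprime m n ∧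
      2 ≤ (m * n).natAbs.primeFactors.card ∧
      ∃ θ : Multiplicative ℤ →* MulAut (MetabelianBaumslagSolitar m n),
        Nonempty (G ≃* MetabelianBaumslagSolitar m n ⋊[θ] Multiplicative ℤ) := by
  have hG : HasHirschLength G 3 := hasHirschLength_of_hirschLength_eq (by decide) h3
  have h4 : ¬ NontorsionChain (⊤ : Subgroup G) 4 := fun h =>
    absurd (hG.le_of_chain h) (by decide)
  have h2 := not_chain_two_of_hirschLength_eq_one h1
  have hne := hirschPlotkinRadical_ne_bot h1
  have hA := hirschPlotkinRadical_isTorsionFreeAbelian htf h2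
  exact exists_metabelianBaumslagSolitar_semidirectProduct htf hA h2 hne
    (centralizer_hirschPlotkinRadical_le htf ⟨_, hG⟩ h4 hne hA) (hG.chain_of_le le_rfl) h4
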